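/- Let $q>p\ge 0$ be even integers. For a finite connected graph $G$ with distance function $\rho$, the polygraph $G_S$, $S=[p,q,p+q]$, has vertex set $V(G)^3$, and $(x_1,x_2,x_3)$, $(y_1,y_2,y_3)$ are adjacent iff the multisets $[\rho(x_1,y_1),\rho(x_2,y_2),\rho(x_3,y_3)]$ and $[p,q,p+q]$ coincide. The link of a vertex is the subgraph induced on its set of neighbors; a graph is $(a,b)$-regular ($a>b\ge0$) if it is $a$-regular and all its links are $b$-regular. A $d$-regular graph ($d>0$) whose adjacency matrix has eigenvalues $d=\lambda_1\ge\lambda_2\ge\dots\ge\lambda_n$ is an $\epsilon$-spectral expander if $1-\lambda_2/d\ge\epsilon$. Write $\gamma(G)=1-\max\{\lambda_2,-\lambda_n\}/d$ for its (two-sided) normalized spectral gap. There are functions $a,b:\mathbb N\to\mathbb N$, a constant $\epsilon>0$ and a function $\epsilon':\mathbb R\to\mathbb R$ that is positive on $(0,\infty)$, all depending only on $p$ and $q$, such that the following holds for every $d\ge 3$ and every finite $d$-regular graph $G$ that is connected, non-bipartite and of girth bigger than $3p+3q$: the polygraph $G_{[p,q,p+q]}$ is $(a(d),b(d))$-regular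 with $b(d)>0$; each of its links is an $\epsilon$-spectral expander; and $\gamma(G)>0$, and $G_{[p,q,p+q]}$ is an $\epsilon'(\gamma)$-spectral expander for every $0<\gamma\le\gamma(G)$. -/

import Mathlib

universe u

/-- The polygraph `G_S` on `V^m`: two `m`-tuples are adjacent iff the multiset of their coordinatewise
graph distances is `S`. (The clause `x ≠ y` only matters when all members of `S` are zero, where it
removes the loops.) -/
def polygraph {V : Type*} (G : SimpleGraph V) {m : ℕ} (S : Multiset ℕ) :
    SimpleGraph (Fin m → V) where
  Adj x y := x ≠ y ∧ (Finset.univ : Finset (Fin m)).val.map (fun i => G.dist (x i) (y i)) = S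
  symm := ⟨fun x y h => ⟨h.1.symm, by simpa only [SimpleGraph.dist_comm] using h.2⟩⟩
  loopless := ⟨fun _ h => h.1 rfl⟩

/-- The link of `v`: the subgraph induced on the set of neighbours of `v`. -/
abbrev link {V : Type*} (G : SimpleGraph V) (v : V) : SimpleGraph (G.neighborSet v) :=
  G.induce (G.neighborSet v)

open Classical in
/-- `G` is `(a,b)`-regular: `a > b ≥ 0`, `G` is `a`-regular and all its links are `b`-regular. -/
def IsABRegular {V : Type*} [Fintype V] (G : SimpleGraph V) (a b : ℕ) : Prop :=
  b < a ∧ G.IsRegularOfDegree a ∧ ∀ v : V, (link G v).IsRegularOfDegree b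

open Classical in
/-- The eigenvalues `λ_1 ≥ λ_2 ≥ … ≥ λ_n` of the adjacency matrix, with multiplicity;
`adjEigenvalue G k` is `λ_k` for `1 ≤ k ≤ n` (and `0` for other `k`). -/
noncomputable def adjEigenvalue {V : Type*} [Fintype V] (G : SimpleGraph V) (k : ℕ) : ℝ :=
  if h : 1 ≤ k ∧ k ≤ Fintype.card V then
    (G.isHermitian_adjMatrix ℝ).eigenvalues₀ ⟨k - 1, by omega⟩
  else 0

open Classical in
/-- `G` is a `d`-regular `ε`-spectral expander: `1 - λ_2 / d ≥ ε`. The degree is positive, so that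
the normalized gap makes sense. -/
def IsSpectralExpander {V : Type*} [Fintype V] (G : SimpleGraph V) (d : ℕ) (ε : ℝ) : Prop :=
  0 < d ∧ G.IsRegularOfDegree d ∧ ε ≤ 1 - adjEigenvalue G 2 / d

open Classical in
/-- All links of `G` are `b`-regular `ε`-spectral expanders. -/
def IsLocalSpectralExpander {V : Type*} [Fintype V] (G : SimpleGraph V) (b : ℕ) (ε : ℝ) : Prop :=
  ∀ v : V, IsSpectralExpander (link G v) b ε

/-- `λ(G) = max {λ_2, -λ_n}`. -/
noncomputable def lambdaMax {V : Type*} [Fintype V] (G : SimpleGraph V) : ℝ :=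
  max (adjEigenvalue G 2) (-adjEigenvalue G (Fintype.card V))

/-- The normalized spectral gap `1 - λ(G) / d` of a `d`-regular graph, where
`λ(G) = max {λ_2, -λ_n}`. -/
noncomputable def spectralGap {V : Type*} [Fintype V] (G : SimpleGraph V) (d : ℕ) : ℝ :=
  1 - lambdaMax G / d

/-! Put `R = 3(p+q)/2`. Girth above `2R` makes three points of perimeter at most `2R` look like
three points of the `d`-regular tree. As `p` and `q` are even, the three distances always have even
sum, so the number of third vertices of a triangle with given sides depends on `d` only
(`IsTreeLike.card_triangle`). Once arrangements of `p, q, p+q` are fixed, the coordinates of a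
neighbour are chosen independently; hence `a(d)` and `b(d)` are sums of products of such counts.

Links: let `h = √(d-1)`. The triangle count for sides `i, j, k` is `h^(j+k-i)` up to a factor 2, so
a link has at least about `h^(4(p+q))` vertices and degree at most about `h^(2(p+q))`. It suffices
to find, between any two vertices of a link, about `h^(12(p+q))` walks of length 8: such a
minorization bounds every nontrivial eigenvalue away from the degree, uniformly in `d`
(`Matrix.abs_eigenvalue_pow_le`). The walks exist because `p+q` is a member of `S`: a move of length
`p+q` between the spheres of radii `p` and `q` about the centre runs through the centre, and two
such moves in a row forget where they began (`isSpread_cross`). Only one coordinate at a time can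
move by `p+q`, so the three coordinates are refreshed in turn (`isSpread_refreshingSteps`).

Globally, products of adjacency eigenvectors of `G` form a complete system of eigenvectors of the
polygraph. The eigenvalue is a sum over arrangements of sphere sizes times spherical functions of
the tree (`polygraph_mulVec_prod`). A decreasing quadratic energy shows that these functions stay
below `1 - 3γ/8` in absolute value at every positive radius when the eigenvalue of `G` is nontrivial
(`abs_sphericalValue_succ_le`). The two-sided gap is needed since at even radii the eigenvalue `-d`
would count like `d`; it is positive because `G` is connected and not bipartite. -/

open Finset Matrix

/-! ### Short cycles from pairs of paths -/

namespace SimpleGraph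

/-- Two distinct paths with the same ends produce a cycle no longer than the two paths together. -/
theorem egirth_le_of_isPath_ne {V : Type*} {G : SimpleGraph V} {u v : V} {p q : G.Walk u v}
    (hp : p.IsPath) (hq : q.IsPath) (hne : p ≠ q) :
    G.egirth ≤ ((p.length + q.length : ℕ) : ℕ∞) := by
  classical
  -- With only the edges of the two paths kept, any cycle is automatically short enough.
  set H : SimpleGraph V := fromEdgeSet {e | e ∈ p.edges ++ q.edges} with hH
  have hHe : H.edgeSet ⊆ {e | e ∈ p.edges ++ q.edges} := by
    rw [hH, edgeSet_fromEdgeSet]; exact Set.sdiff_subset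
  have hHG : H ≤ G := by
    rw [← edgeSet_subset_edgeSet]
    intro e he
    have := hHe he
    simp only [Set.mem_ofPred_eq, List.mem_append] at this
    exact this.elim (fun h => p.edges_subset_edgeSet h) (fun h => q.edges_subset_edgeSet h)
  have hmem : ∀ e, e ∈ G.edgeSet → e ∈ p.edges ++ q.edges → e ∈ H.edgeSet := by
    intro e he h
    rw [hH, edgeSet_fromEdgeSet]
    exact ⟨h, G.not_isDiag_of_mem_edgeSet he⟩
  have hpH : ∀ e ∈ p.edges, e ∈ H.edgeSet := fun e he =>
    hmem e (p.edges_subset_edgeSet he) (List.mem_append_left _ he)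
  have hqH : ∀ e ∈ q.edges, e ∈ H.edgeSet := fun e he =>
    hmem e (q.edges_subset_edgeSet he) (List.mem_append_right _ he)
  have hac : ¬ H.IsAcyclic := by
    intro hac
    have h := (hac.subsingleton_path u v).elim ⟨p.transfer H hpH, hp.transfer hpH⟩
      ⟨q.transfer H hqH, hq.transfer hqH⟩
    have h' : p.transfer H hpH = q.transfer H hqH := congrArg Subtype.val h
    apply hne
    have := congrArg Walk.support h'
    rw [Walk.support_transfer, Walk.support_transfer] at this
    exact Walk.ext_support this
  rw [IsAcyclic] at hac
  push Not at hac
  obtain ⟨a, w, hw⟩ := hac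
  refine (egirth_anti hHG).trans ((egirth_le_length hw).trans ?_)
  have hsub : w.edges.toFinset ⊆ (p.edges ++ q.edges).toFinset := by
    intro e he
    rw [List.mem_toFinset] at he ⊢
    exact hHe (w.edges_subset_edgeSet he)
  have h1 := Finset.card_le_card hsub
  rw [List.toFinset_card_of_nodup hw.isCircuit.isTrail.edges_nodup, Walk.length_edges] at h1
  have h2 := h1.trans (List.toFinset_card_le _)
  rw [List.length_append, Walk.length_edges, Walk.length_edges] at h2
  exact_mod_cast h2

end SimpleGraph

/-! ### Large girth and local tree structure -/

/-- Up to radius `R` the graph looks like a tree around every vertex: a vertex at distance at most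
`R` from `x` has at most one neighbour closer to `x`, and a vertex at distance less than `R` has no
neighbour at its own distance. -/
structure IsTreeLike {V : Type*} (G : SimpleGraph V) (R : ℕ) : Prop where
  parent_unique : ∀ ⦃x z w w' : V⦄, G.dist x z ≤ R → G.Adj z w → G.Adj z w' →
    G.dist x w + 1 = G.dist x z → G.dist x w' + 1 = G.dist x z → w = w'
  dist_ne : ∀ ⦃x z w : V⦄, G.dist x z < R → G.Adj z w → G.dist x w ≠ G.dist x z

section TreeLike

variable {V : Type*} {G : SimpleGraph V}

/-- A vertex other than `x` has a neighbour closer to `x`. -/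
theorem exists_adj_dist_add_one (hc : G.Connected) {x z : V} (h : x ≠ z) :
    ∃ w, G.Adj z w ∧ G.dist x w + 1 = G.dist x z := by
  obtain ⟨w, hw⟩ := hc.exists_walk_length_eq_dist z x
  cases w with
  | nil => exact absurd rfl h
  | @cons _ w _ hzw t =>
    refine ⟨w, hzw, ?_⟩
    rw [SimpleGraph.Walk.length_cons] at hw
    have h1 := SimpleGraph.dist_le t
    have h2 := hc.dist_triangle (u := x) (v := w) (w := z)
    rw [SimpleGraph.dist_eq_one_iff_adj.mpr hzw.symm] at h2
    rw [SimpleGraph.dist_comm] at h1 hw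
    omega

/-- Distances to a fixed vertex change by at most one along an edge. -/
theorem dist_le_dist_add_one (hc : G.Connected) (x : V) {z w : V} (h : G.Adj z w) :
    G.dist x w ≤ G.dist x z + 1 ∧ G.dist x z ≤ G.dist x w + 1 := by
  have h1 := hc.dist_triangle (u := x) (v := w) (w := z)
  have h2 := hc.dist_triangle (u := x) (v := z) (w := w)
  rw [SimpleGraph.dist_eq_one_iff_adj.mpr h] at h2
  rw [SimpleGraph.dist_eq_one_iff_adj.mpr h.symm] at h1
  exact ⟨h2, h1⟩

/-- A violation of either property gives two distinct paths with common ends, of total length at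
most `2R` (two equal lengths, respectively lengths differing by one), hence a forbidden cycle. -/
theorem isTreeLike_of_lt_egirth (hc : G.Connected) {R : ℕ} (hg : ((2 * R : ℕ) : ℕ∞) < G.egirth) :
    IsTreeLike G R := by
  have key : ∀ {x z : V} (p q : G.Walk x z), p.IsPath → q.IsPath →
      p.length + q.length ≤ 2 * R → p = q := by
    intro x z p q hp hq hl
    by_contra hne
    have := hg.trans_le (SimpleGraph.egirth_le_of_isPath_ne hp hq hne)
    have : 2 * R < p.length + q.length := by exact_mod_cast this
    omega
  constructor
  · intro x z w w' hR hw hw' hd hd'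
    obtain ⟨p, hp⟩ := hc.exists_walk_length_eq_dist x w
    obtain ⟨p', hp'⟩ := hc.exists_walk_length_eq_dist x w'
    have hl : (p.concat hw.symm).length = G.dist x z := by simp [hp, hd]
    have hl' : (p'.concat hw'.symm).length = G.dist x z := by simp [hp', hd']
    have h := key _ _ ((p.concat hw.symm).isPath_of_length_eq_dist hl)
      ((p'.concat hw'.symm).isPath_of_length_eq_dist hl') (by omega)
    have := congrArg SimpleGraph.Walk.penultimate h
    simpa using this
  · intro x z w hR hw he
    obtain ⟨p, hp, hpl⟩ := hc.exists_path_of_dist x w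
    obtain ⟨p', hp', hpl'⟩ := hc.exists_path_of_dist x z
    have hz : z ∉ p.support := by
      classical
      intro hz
      have h1 := SimpleGraph.dist_le (p.takeUntil z hz)
      have h2 := SimpleGraph.Walk.length_takeUntil_lt_length hz hw.ne
      omega
    have h := key _ _ (hp.concat hz hw.symm) hp'
      (by rw [SimpleGraph.Walk.length_concat]; omega)
    have := congrArg SimpleGraph.Walk.length h
    rw [SimpleGraph.Walk.length_concat] at this
    omega

variable {R : ℕ}

/-- If `z` is not on a geodesic from `x` to `y`, then the neighbours of `z` towards `x` and towards
`y` agree. -/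
theorem IsTreeLike.parent_eq (hT : IsTreeLike G R) (hc : G.Connected) {l : ℕ} :
    ∀ {x y z w w' : V}, G.dist y z = l → G.dist x y < G.dist x z + G.dist y z →
      G.dist x y + G.dist x z + G.dist y z ≤ 2 * R → G.Adj z w → G.Adj z w' →
      G.dist x w + 1 = G.dist x z → G.dist y w' + 1 = G.dist y z → w = w' := by
  induction l with
  | zero => intro x y z w w' hl _ _ _ _ _ h'; omega
  | succ l ih =>
    intro x y z w w' hl hlt hper hw hw' hd hd'
    have tri := fun a b c : V => hc.dist_triangle (u := a) (v := b) (w := c)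
    by_cases hxy : x = y
    · subst hxy
      exact hT.parent_unique (by omega) hw hw' hd hd'
    have hzy : z ≠ y := by
      rintro rfl
      simp at hl
    obtain ⟨y', hy', hdy'⟩ := exists_adj_dist_add_one hc hzy
    have hny := hT.dist_ne (x := x) (z := y) (w := y') (by omega) hy'
    have hby := dist_le_dist_add_one hc x hy'
    have hyz : G.dist y' z + 1 = G.dist y z := by
      rw [SimpleGraph.dist_comm, hdy', SimpleGraph.dist_comm]
    rcases Nat.eq_zero_or_pos l with rfl | hlpos
    · have : y' = z := hc.dist_eq_zero_iff.mp (by omega)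
      subst this
      have hw'y : w' = y := (hc.dist_eq_zero_iff.mp (by omega : G.dist y w' = 0)).symm
      subst hw'y
      exact hT.parent_unique (by omega) hw hw' hd (by omega)
    · have hzy' : y' ≠ z := by
        rintro rfl
        simp at hyz
        omega
      obtain ⟨v, hv, hdv⟩ := exists_adj_dist_add_one hc hzy'
      have hvw : v = w' := by
        refine hT.parent_unique (x := y) (z := z) ?_ hv hw' ?_ hd'
        · have := tri y x z; rw [G.dist_comm (u := y) (v := x)] at this; omega
        · have h1 := tri y y' v
          rw [SimpleGraph.dist_eq_one_iff_adj.mpr hy'] at h1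
          have h2 := (dist_le_dist_add_one hc y hv).2
          omega
      subst hvw
      rcases lt_or_ge (G.dist x y') (G.dist x y) with hlt' | hge
      · exact ih (x := x) (y := y') (z := z) (by omega) (by omega) (by omega) hw hv hd hdv
      · have hxy' : G.dist x y' = G.dist x y + 1 := by omega
        rcases lt_or_ge (G.dist x y') (G.dist x z + G.dist y' z) with h1 | h1
        · exact ih (x := x) (y := y') (z := z) (by omega) h1 (by omega) hw hv hd hdv
        -- Here `z` lies on a geodesic from `x` to `y'`, while `y` is also closer to `x` than `y'`
        -- is. Uniqueness of the parent of `y'` then identifies `y` with the neighbour of `y'`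
        -- towards `z`, although `y` is farther from `z`.
        · exfalso
          obtain ⟨u, hu, hdu⟩ := exists_adj_dist_add_one hc hzy'.symm
          have h2 := tri x z u
          have h3 := (dist_le_dist_add_one hc x hu).2
          have h4 : G.dist z y' = G.dist y' z := G.dist_comm
          have huy : u = y := hT.parent_unique (x := x) (z := y') (by omega) hu hy'.symm
            (by omega) (by omega)
          subst huy
          have h5 : G.dist z u = G.dist u z := G.dist_comm
          omega

end TreeLike

/-! ### Counting vertices of tree triangles -/

/-- The number of vertices `z` at distance `α + κ` from `x` and `β + κ` from `y` in the `d`-regular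
tree, where `x` and `y` are at distance `α + β`. -/
def tripodCount (d α β κ : ℕ) : ℕ :=
  if κ = 0 then 1
  else (d - (if α = 0 then 0 else 1) - (if β = 0 then 0 else 1)) * (d - 1) ^ (κ - 1)

section Counting

variable {V : Type*} [Fintype V] {G : SimpleGraph V} {R d : ℕ}

theorem IsTreeLike.card_parents (hT : IsTreeLike G R) (hc : G.Connected) {x w : V}
    (h : G.dist x w ≤ R) :
    #{z | G.dist w z = 1 ∧ G.dist x z + 1 = G.dist x w} = if G.dist x w = 0 then 0 else 1 := by
  split_ifs with h0
  · simp [h0]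
  · have hne : x ≠ w := by rintro rfl; simp at h0
    obtain ⟨v, hv, hdv⟩ := exists_adj_dist_add_one hc hne
    rw [card_eq_one]
    refine ⟨v, ?_⟩
    ext z
    simp only [mem_filter, mem_univ, true_and, mem_singleton, SimpleGraph.dist_eq_one_iff_adj]
    constructor
    · rintro ⟨hz, hdz⟩
      exact hT.parent_unique h hz hv hdz hdv
    · rintro rfl
      exact ⟨hv, hdv⟩

/-- The neighbours of `w` that are farther than `w` from both `x` and `y`. -/
theorem IsTreeLike.card_children (hT : IsTreeLike G R) (hc : G.Connected)
    (hreg : ∀ v, #{w | G.dist v w = 1} = d) {x y w : V} {α β κ : ℕ}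
    (hxy : G.dist x y = α + β) (hx : G.dist x w = α + κ) (hy : G.dist y w = β + κ)
    (hR : α + β + κ < R) :
    #{z | G.dist w z = 1 ∧ G.dist x z = α + (κ + 1) ∧ G.dist y z = β + (κ + 1)} =
      if κ = 0 then d - (if α = 0 then 0 else 1) - (if β = 0 then 0 else 1) else d - 1 := by
  classical
  set N : Finset V := {z | G.dist w z = 1}
  set Px : Finset V := {z | G.dist w z = 1 ∧ G.dist x z + 1 = G.dist x w} with hPx
  set Py : Finset V := {z | G.dist w z = 1 ∧ G.dist y z + 1 = G.dist y w} with hPy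
  have hset : ({z | G.dist w z = 1 ∧ G.dist x z = α + (κ + 1) ∧ G.dist y z = β + (κ + 1)} :
      Finset V) = N \ (Px ∪ Py) := by
    ext z
    simp only [N, Px, Py, mem_filter, mem_univ, true_and, mem_sdiff, mem_union]
    constructor
    · rintro ⟨h1, h2, h3⟩
      exact ⟨h1, by omega⟩
    · rintro ⟨h1, h2⟩
      have hadj := SimpleGraph.dist_eq_one_iff_adj.mp h1
      have a1 := dist_le_dist_add_one hc x hadj
      have a2 := dist_le_dist_add_one hc y hadj
      have b1 := hT.dist_ne (x := x) (by omega) hadj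
      have b2 := hT.dist_ne (x := y) (by omega) hadj
      exact ⟨h1, by omega, by omega⟩
  have hsub : Px ∪ Py ⊆ N := by
    intro z
    simp only [N, Px, Py, mem_filter, mem_univ, true_and, mem_union]
    tauto
  have cx : #Px = if G.dist x w = 0 then 0 else 1 := hT.card_parents hc (by omega)
  have cy : #Py = if G.dist y w = 0 then 0 else 1 := hT.card_parents hc (by omega)
  rw [hset, card_sdiff_of_subset hsub, hreg]
  rcases Nat.eq_zero_or_pos κ with rfl | hκ
  -- For `κ = 0` the vertex `w` lies on the geodesic, and a common parent would shortcut it.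
  · have hdis : Disjoint Px Py := by
      rw [disjoint_left]
      intro z hz hz'
      simp only [Px, Py, mem_filter, mem_univ, true_and] at hz hz'
      have := hc.dist_triangle (u := x) (v := z) (w := y)
      rw [G.dist_comm (u := z)] at this
      omega
    rw [card_union_of_disjoint hdis, cx, cy, hx, hy, if_pos rfl, Nat.sub_add_eq]
    rfl
  · have heq : Px = Py := by
      have h1 : #Px = 1 := by rw [cx, if_neg (by omega)]
      have h2 : #Py = 1 := by rw [cy, if_neg (by omega)]
      obtain ⟨u, hu⟩ := card_eq_one.mp h1
      obtain ⟨v, hv⟩ := card_eq_one.mp h2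
      have hu' : u ∈ Px := hu ▸ mem_singleton_self u
      have hv' : v ∈ Py := hv ▸ mem_singleton_self v
      simp only [Px, Py, mem_filter, mem_univ, true_and,
        SimpleGraph.dist_eq_one_iff_adj] at hu' hv'
      have := hT.parent_eq hc (x := x) (y := y) (z := w) rfl (by omega) (by omega)
        hu'.1 hv'.1 hu'.2 hv'.2
      rw [hu, hv, this]
    rw [← heq, union_self, cx, if_neg (by omega), if_neg (by omega)]

/-- The vertices counted branch off the geodesic at its point at distance `α` from `x`. Induction on
`κ` double counts parent-child pairs: each vertex at level `κ + 1` has exactly one parent at level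
`κ`, by `IsTreeLike.parent_eq`. -/
theorem IsTreeLike.card_tripod (hT : IsTreeLike G R) (hc : G.Connected)
    (hreg : ∀ v, #{w | G.dist v w = 1} = d) {x y : V} {α β : ℕ}
    (hxy : G.dist x y = α + β) :
    ∀ {κ : ℕ}, α + β + κ ≤ R →
    #{z | G.dist x z = α + κ ∧ G.dist y z = β + κ} = tripodCount d α β κ := by
  have geod : ∀ {β : ℕ} {y : V}, G.dist x y = α + β → α + β ≤ R →
      #{z | G.dist x z = α ∧ G.dist y z = β} = 1 := by
    intro β
    induction β with
    | zero =>
      intro y hxy _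
      rw [card_eq_one]
      refine ⟨y, ?_⟩
      ext z
      simp only [mem_filter, mem_univ, true_and, mem_singleton, hc.dist_eq_zero_iff]
      constructor
      · rintro ⟨-, h⟩; exact h.symm
      · rintro rfl; exact ⟨hxy, rfl⟩
    | succ β ih =>
      intro y hxy hR
      have hne : x ≠ y := by rintro rfl; simp at hxy
      obtain ⟨y', hy', hd'⟩ := exists_adj_dist_add_one hc hne
      refine Eq.trans ?_ (ih (y := y') (by omega) (by omega))
      congr 1
      ext z
      simp only [mem_filter, mem_univ, true_and]
      have hyy := SimpleGraph.dist_eq_one_iff_adj.mpr hy'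
      have t1 := hc.dist_triangle (u := x) (v := z) (w := y')
      have t2 := hc.dist_triangle (u := y) (v := y') (w := z)
      rw [G.dist_comm (u := z)] at t1
      constructor
      · rintro ⟨h1, h2⟩
        refine ⟨h1, ?_⟩
        have hzy : z ≠ y := by rintro rfl; simp at h2
        obtain ⟨v, hv, hdv⟩ := exists_adj_dist_add_one hc hzy
        have t3 := hc.dist_triangle (u := x) (v := z) (w := v)
        have t4 := (dist_le_dist_add_one hc x hv).2
        rw [G.dist_comm (u := z) (v := y)] at hdv
        have : v = y' := hT.parent_unique (by omega) hv hy' (by omega) hd'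
        subst this
        rw [G.dist_comm]
        omega
      · rintro ⟨h1, h2⟩
        have t5 := hc.dist_triangle (u := x) (v := z) (w := y)
        rw [G.dist_comm (u := z)] at t5
        exact ⟨h1, by omega⟩
  intro κ
  induction κ with
  | zero =>
    intro hR
    simpa [tripodCount] using geod hxy (by omega)
  | succ κ ih =>
    intro hR
    have hs := ih (by omega)
    have hmul := card_mul_eq_card_mul (fun w z => G.dist w z = 1)
      (s := ({z | G.dist x z = α + κ ∧ G.dist y z = β + κ} : Finset V))
      (t := ({z | G.dist x z = α + (κ + 1) ∧ G.dist y z = β + (κ + 1)} : Finset V))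
      (m := if κ = 0 then d - (if α = 0 then 0 else 1) - (if β = 0 then 0 else 1) else d - 1)
      (n := 1) ?_ ?_
    · rw [mul_one, hs] at hmul
      rw [← hmul, tripodCount, tripodCount]
      rcases Nat.eq_zero_or_pos κ with rfl | hκ
      · simp
      · rw [if_neg (by omega : ¬ κ = 0), if_neg (by omega : ¬ κ = 0),
          if_neg (by omega : ¬ κ + 1 = 0), mul_assoc, ← pow_succ,
          Nat.sub_add_cancel hκ, Nat.add_sub_cancel]
    · intro w hw
      simp only [mem_filter, mem_univ, true_and] at hw
      rw [← hT.card_children hc hreg hxy hw.1 hw.2 (by omega)]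
      congr 1
      ext z
      simp only [bipartiteAbove, mem_filter, mem_univ, true_and]
      tauto
    · intro z hz
      simp only [mem_filter, mem_univ, true_and] at hz
      have hxz : x ≠ z := by rintro rfl; simp at hz
      have hyz : y ≠ z := by rintro rfl; simp at hz
      obtain ⟨w, hw, hdw⟩ := exists_adj_dist_add_one hc hxz
      obtain ⟨w', hw', hdw'⟩ := exists_adj_dist_add_one hc hyz
      have := hT.parent_eq hc (x := x) (y := y) (z := z) rfl (by omega) (by omega) hw hw' hdw hdw'
      subst this
      rw [card_eq_one]
      refine ⟨w, ?_⟩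
      ext v
      simp only [bipartiteBelow, mem_filter, mem_univ, true_and, mem_singleton]
      constructor
      · rintro ⟨⟨h1, h2⟩, h3⟩
        exact hT.parent_unique (x := x) (by omega) (SimpleGraph.dist_eq_one_iff_adj.mp h3).symm hw
          (by omega) hdw
      · rintro rfl
        exact ⟨⟨by omega, by omega⟩, SimpleGraph.dist_eq_one_iff_adj.mpr hw.symm⟩

/-- The number of vertices at distances `j` and `k` from two vertices at distance `i` in the
`d`-regular tree, for `i + j + k` even. -/
def triangleCount (d i j k : ℕ) : ℕ :=
  if i ≤ j + k ∧ j ≤ i + k ∧ k ≤ i + j then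
    tripodCount d ((i + j - k) / 2) ((i + k - j) / 2) ((j + k - i) / 2)
  else 0

theorem IsTreeLike.card_triangle (hT : IsTreeLike G R) (hc : G.Connected)
    (hreg : ∀ v, #{w | G.dist v w = 1} = d) {x y : V} {i j k : ℕ} (hxy : G.dist x y = i)
    (heven : Even (i + j + k)) (hR : i + j + k ≤ 2 * R) :
    #{z | G.dist x z = j ∧ G.dist y z = k} = triangleCount d i j k := by
  rw [triangleCount]
  obtain ⟨m, hm⟩ := heven
  split_ifs with h
  · rw [← hT.card_tripod hc hreg (x := x) (y := y) (by omega) (by omega)]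
    have h1 : (i + j - k) / 2 + (j + k - i) / 2 = j := by omega
    have h2 : (i + k - j) / 2 + (j + k - i) / 2 = k := by omega
    rw [h1, h2]
  · rw [card_eq_zero, filter_eq_empty_iff]
    rintro z - ⟨h1, h2⟩
    have t1 := hc.dist_triangle (u := x) (v := z) (w := y)
    have t2 := hc.dist_triangle (u := x) (v := y) (w := z)
    have t3 := hc.dist_triangle (u := y) (v := x) (w := z)
    rw [G.dist_comm (u := z)] at t1
    rw [G.dist_comm (u := y) (v := x)] at t3
    omega

/-- Points `w` such that the geodesics from `w` to `y` and to `y'` both pass through `o`. -/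
theorem IsTreeLike.card_opposite (hT : IsTreeLike G R) (hc : G.Connected)
    (hreg : ∀ v, #{w | G.dist v w = 1} = d) (hd : 3 ≤ d) {o y y' : V} {s s' t : ℕ}
    (hy : G.dist o y = s) (hy' : G.dist o y' = s') (hR : s + t ≤ R) (hR' : s' + t ≤ R) :
    (d - 1) ^ t ≤
      2 * #{w | G.dist o w = t ∧ G.dist y w = s + t ∧ G.dist y' w = s' + t} := by
  classical
  rcases Nat.eq_zero_or_pos t with rfl | ht
  · have : o ∈ ({w | G.dist o w = 0 ∧ G.dist y w = s + 0 ∧ G.dist y' w = s' + 0} : Finset V) := by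
      simp [G.dist_comm (v := o), hy, hy']
    have := card_pos.mpr ⟨o, this⟩
    simp only [pow_zero]
    omega
  set A : Finset V := {w | G.dist o w = 0 + t ∧ G.dist y w = s + t}
  have hA : #A = tripodCount d 0 s t := hT.card_tripod hc hreg (by omega) (by omega)
  have hAge : (d - 1) ^ t ≤ #A := by
    rw [hA, tripodCount, if_neg (by omega)]
    calc (d - 1) ^ t = (d - 1) * (d - 1) ^ (t - 1) := by
          rw [← pow_succ', Nat.sub_add_cancel ht]
      _ ≤ _ := by
          refine Nat.mul_le_mul_right _ ?_
          split_ifs <;> omega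
  obtain ⟨e, rfl⟩ : ∃ e, d = e + 3 := ⟨d - 3, by omega⟩
  obtain ⟨t, rfl⟩ : ∃ t', t = t' + 1 := ⟨t - 1, by omega⟩
  -- The bad vertices of `A` lie behind the neighbour `o'` of `o` towards `y'`. They fill at most
  -- one branch, of size `(d-1)^(t-1)` in the original `t`, which is at most half of `(d-1)^t`
  -- because `d - 1 ≥ 2`.
  have hbad : #(A.filter fun w => ¬ G.dist y' w = s' + (t + 1)) ≤ (e + 2) ^ t := by
    by_cases hoy : y' = o
    · subst hoy
      rw [filter_eq_empty_iff.mpr]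
      · simp
      · intro w hw
        simp only [A, mem_filter, mem_univ, true_and] at hw
        simp at hy'
        omega
    obtain ⟨o', ho', hd'⟩ := exists_adj_dist_add_one hc hoy
    have hsub : (A.filter fun w => ¬ G.dist y' w = s' + (t + 1)) ⊆
        ({w | G.dist o w = 1 + t ∧ G.dist o' w = 0 + t} : Finset V) := by
      intro w hw
      simp only [A, mem_filter, mem_univ, true_and] at hw ⊢
      refine ⟨by omega, ?_⟩
      have how : w ≠ o := by rintro rfl; simp at hw
      obtain ⟨v, hv, hdv⟩ := exists_adj_dist_add_one hc how
      have t1 := hc.dist_triangle (u := y') (v := o) (w := w)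
      rw [G.dist_comm (v := o)] at t1 hd'
      rw [G.dist_comm (u := w) (v := o)] at hdv
      have := hT.parent_eq hc (x := y') (y := w) (z := o) rfl
        (by rw [G.dist_comm (v := o), G.dist_comm (v := o)]; omega)
        (by rw [G.dist_comm (v := o), G.dist_comm (v := o)]; omega) ho' hv
        (by rw [G.dist_comm (u := y') (v := o)]; omega)
        (by rw [G.dist_comm (u := w) (v := o)]; omega)
      subst this
      rw [G.dist_comm]
      omega
    refine (card_le_card hsub).trans ?_
    rw [hT.card_tripod hc hreg (SimpleGraph.dist_eq_one_iff_adj.mpr ho') (by omega), tripodCount]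
    by_cases h1 : t = 0
    · simp [h1]
    · rw [if_neg h1, if_neg one_ne_zero, if_pos rfl]
      change (e + 2) * (e + 2) ^ (t - 1) ≤ (e + 2) ^ t
      rw [← pow_succ', Nat.sub_add_cancel (Nat.pos_of_ne_zero h1)]
  have hsplit := card_filter_add_card_filter_not (s := A) (fun w => G.dist y' w = s' + (t + 1))
  have hgood : (A.filter fun w => G.dist y' w = s' + (t + 1)) =
      ({w | G.dist o w = t + 1 ∧ G.dist y w = s + (t + 1) ∧ G.dist y' w = s' + (t + 1)} :
        Finset V) := by
    ext w
    simp only [A, mem_filter, mem_univ, true_and, zero_add]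
    tauto
  rw [hgood] at hsplit
  have hpow : (e + 3 - 1) ^ (t + 1) = (e + 2) * (e + 2) ^ t := by rw [pow_succ']; rfl
  have : 2 * (e + 2) ^ t ≤ (e + 2) * (e + 2) ^ t := by gcongr; omega
  omega

end Counting

/-! ### Eigenvalues of regular graphs -/

section Spectral

variable {V : Type*} [Fintype V] {G : SimpleGraph V}

theorem Matrix.pow_mulVec_of_eigenvector [DecidableEq V] {M : Matrix V V ℝ} {f : V → ℝ} {μ : ℝ}
    (h : M *ᵥ f = μ • f) (k : ℕ) : (M ^ k) *ᵥ f = μ ^ k • f := by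
  induction k with
  | zero => simp
  | succ k ih => rw [pow_succ, ← mulVec_mulVec, h, mulVec_smul, ih, smul_smul, pow_succ, mul_comm]

/-- If all entries of `M ^ k` are at least `m`, then the eigenvalues of `M` on vectors of sum zero
are bounded away from the row sum. -/
theorem Matrix.abs_eigenvalue_pow_le [DecidableEq V] {M : Matrix V V ℝ} {m b : ℝ} {k : ℕ}
    (hm : ∀ y z, m ≤ (M ^ k) y z) (hrow : ∀ y, ∑ z, M y z = b) {f : V → ℝ} {μ : ℝ} (hf : f ≠ 0)
    (hs : ∑ x, f x = 0) (h : M *ᵥ f = μ • f) : |μ| ^ k ≤ b ^ k - m * Fintype.card V := by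
  have h1 : M *ᵥ (fun _ => (1 : ℝ)) = b • (fun _ => (1 : ℝ)) := by
    ext y
    simp [mulVec, dotProduct, hrow]
  have hrowk : ∀ y, ∑ z, (M ^ k) y z = b ^ k := by
    intro y
    have := congrFun (pow_mulVec_of_eigenvector h1 k) y
    simpa [mulVec, dotProduct] using this
  obtain ⟨x, hx⟩ := Function.ne_iff.mp hf
  obtain ⟨y, -, hy⟩ := exists_max_image univ (fun y => |f y|) ⟨x, mem_univ x⟩
  have hpos : 0 < |f y| := (abs_pos.mpr hx).trans_le (hy x (mem_univ x))
  -- Subtracting the constant `m` from all entries does not change the action on vectors of sum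
  -- zero, keeps the entries nonnegative and lowers the row sums by `m * card V`. The maximum
  -- principle at `y` does the rest.
  have hk : ∑ z, ((M ^ k) y z - m) * f z = μ ^ k * f y := by
    have := congrFun (pow_mulVec_of_eigenvector h k) y
    simp only [mulVec, dotProduct, Pi.smul_apply, smul_eq_mul] at this
    simp_rw [sub_mul, sum_sub_distrib, this, ← mul_sum, hs, mul_zero, sub_zero]
  refine le_of_mul_le_mul_right ?_ hpos
  calc |μ| ^ k * |f y| = |∑ z, ((M ^ k) y z - m) * f z| := by rw [hk, abs_mul, abs_pow]
    _ ≤ ∑ z, ((M ^ k) y z - m) * |f y| := by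
        refine (abs_sum_le_sum_abs _ _).trans (sum_le_sum fun z _ => ?_)
        rw [abs_mul, abs_of_nonneg (sub_nonneg.mpr (hm y z))]
        exact mul_le_mul_of_nonneg_left (hy z (mem_univ z)) (sub_nonneg.mpr (hm y z))
    _ = (b ^ k - m * Fintype.card V) * |f y| := by
        rw [← sum_mul, sum_sub_distrib, hrowk]
        simp [mul_comm]

variable [DecidableRel G.Adj] {d : ℕ}

theorem adjMatrix_dotProduct_comm (f g : V → ℝ) :
    (G.adjMatrix ℝ *ᵥ f) ⬝ᵥ g = f ⬝ᵥ (G.adjMatrix ℝ *ᵥ g) := by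
  conv_rhs => rw [dotProduct_mulVec, ← mulVec_transpose, SimpleGraph.transpose_adjMatrix]

theorem mul_dotProduct_of_eigenvectors {f g : V → ℝ} {μ ν : ℝ}
    (hf : G.adjMatrix ℝ *ᵥ f = μ • f) (hg : G.adjMatrix ℝ *ᵥ g = ν • g) :
    (μ - ν) * (f ⬝ᵥ g) = 0 := by
  have := adjMatrix_dotProduct_comm (G := G) f g
  rw [hf, hg, smul_dotProduct, dotProduct_smul, smul_eq_mul, smul_eq_mul] at this
  linarith

theorem adjMatrix_mulVec_one (hreg : G.IsRegularOfDegree d) :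
    G.adjMatrix ℝ *ᵥ (fun _ => (1 : ℝ)) = (d : ℝ) • (fun _ => (1 : ℝ)) := by
  ext v
  have := G.adjMatrix_mulVec_const_apply (α := ℝ) (a := 1) (v := v)
  rw [hreg v] at this
  simpa [Function.const_def] using this

theorem sum_eq_zero_of_eigenvector (hreg : G.IsRegularOfDegree d) {f : V → ℝ} {μ : ℝ}
    (hf : G.adjMatrix ℝ *ᵥ f = μ • f) : (μ - d) * ∑ x, f x = 0 := by
  simpa [dotProduct] using mul_dotProduct_of_eigenvectors hf (adjMatrix_mulVec_one hreg)

/-- The Dirichlet form of a regular graph, with either sign. -/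
theorem sum_adj_sq (hreg : G.IsRegularOfDegree d) {f : V → ℝ} {μ s : ℝ} (hs : s ^ 2 = 1)
    (hf : G.adjMatrix ℝ *ᵥ f = μ • f) :
    ∑ x, ∑ y, G.adjMatrix ℝ x y * (f x - s * f y) ^ 2 = 2 * (d - s * μ) * ∑ x, f x ^ 2 := by
  have h1 : ∀ x, ∑ y, G.adjMatrix ℝ x y = d := by
    intro x
    simpa [mulVec, dotProduct] using congrFun (adjMatrix_mulVec_one hreg) x
  have h2 : ∀ x, ∑ y, G.adjMatrix ℝ x y * f y = μ * f x := by
    intro x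
    simpa [mulVec, dotProduct] using congrFun hf x
  have h3 : ∑ x, ∑ y, G.adjMatrix ℝ x y * f y ^ 2 = d * ∑ x, f x ^ 2 := by
    rw [sum_comm, mul_sum]
    refine sum_congr rfl fun y _ => ?_
    rw [← sum_mul, ← h1 y]
    congr 1
    refine sum_congr rfl fun x _ => ?_
    simp [SimpleGraph.adj_comm]
  have h4 : ∀ x, ∑ y, G.adjMatrix ℝ x y * (f x - s * f y) ^ 2 =
      d * f x ^ 2 - 2 * s * μ * f x ^ 2 + ∑ y, G.adjMatrix ℝ x y * f y ^ 2 := by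
    intro x
    have : ∀ y, G.adjMatrix ℝ x y * (f x - s * f y) ^ 2 = G.adjMatrix ℝ x y * f x ^ 2 -
        2 * s * f x * (G.adjMatrix ℝ x y * f y) + G.adjMatrix ℝ x y * f y ^ 2 := by
      intro y
      linear_combination (G.adjMatrix ℝ x y * f y ^ 2) * hs
    simp_rw [this, sum_add_distrib, sum_sub_distrib, ← sum_mul, ← mul_sum, h1, h2]
    ring
  simp_rw [h4, sum_add_distrib, sum_sub_distrib, ← mul_sum, h3]
  ring

/-- When `d ≤ s * μ` the Dirichlet form of `sum_adj_sq` is nonpositive, so all of its terms vanish.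
The signs `s = 1` and `s = -1` serve the two ends of the spectrum. -/
theorem eq_mul_of_adj_of_eigenvector (hreg : G.IsRegularOfDegree d) {f : V → ℝ} {μ s : ℝ}
    (hs : s ^ 2 = 1) (hf : G.adjMatrix ℝ *ᵥ f = μ • f) (hμ : d ≤ s * μ) {x y : V}
    (h : G.Adj x y) : f x = s * f y := by
  have hnn : ∀ x y, 0 ≤ G.adjMatrix ℝ x y * (f x - s * f y) ^ 2 := by
    intro x y
    refine mul_nonneg ?_ (sq_nonneg _)
    rw [SimpleGraph.adjMatrix_apply]
    split_ifs <;> simp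
  have h0 : ∑ x, ∑ y, G.adjMatrix ℝ x y * (f x - s * f y) ^ 2 = 0 := by
    refine le_antisymm ?_ (sum_nonneg fun x _ => sum_nonneg fun y _ => hnn x y)
    rw [sum_adj_sq hreg hs hf]
    have : 0 ≤ ∑ x, f x ^ 2 := sum_nonneg fun x _ => sq_nonneg _
    nlinarith
  have h1 := (sum_eq_zero_iff_of_nonneg fun x _ => sum_nonneg fun y _ => hnn x y).mp h0 x
    (mem_univ x)
  have h2 := (sum_eq_zero_iff_of_nonneg fun y _ => hnn x y).mp h1 y (mem_univ y)
  rw [SimpleGraph.adjMatrix_apply, if_pos h, one_mul] at h2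
  have := pow_eq_zero_iff (two_ne_zero) |>.mp h2
  linarith

theorem lt_of_connected_of_eigenvector (hreg : G.IsRegularOfDegree d) (hc : G.Connected)
    {f : V → ℝ} {μ : ℝ} (hf0 : f ≠ 0) (hsum : ∑ x, f x = 0)
    (hf : G.adjMatrix ℝ *ᵥ f = μ • f) : μ < d := by
  by_contra hμ
  push Not at hμ
  have hadj : ∀ x y, G.Adj x y → f x = f y := fun x y h => by
    simpa using eq_mul_of_adj_of_eigenvector (s := 1) hreg (by norm_num) hf (by linarith) h
  have hwalk : ∀ x y (w : G.Walk x y), f x = f y := by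
    intro x y w
    induction w with
    | nil => rfl
    | cons h _ ih => exact (hadj _ _ h).trans ih
  obtain ⟨x, hx⟩ := Function.ne_iff.mp hf0
  have hconst : ∀ y, f y = f x := fun y => (hc.preconnected y x).elim fun w => hwalk y x w
  simp only [hconst, sum_const, card_univ, nsmul_eq_mul] at hsum
  have hcard : (Fintype.card V : ℝ) ≠ 0 := by
    have : 0 < Fintype.card V := Fintype.card_pos_iff.mpr ⟨x⟩
    positivity
  exact hx (by simpa [hcard] using hsum)

theorem neg_lt_of_not_isBipartite_of_eigenvector (hreg : G.IsRegularOfDegree d) (hc : G.Connected)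
    (hb : ¬ G.IsBipartite) {f : V → ℝ} {μ : ℝ} (hf0 : f ≠ 0)
    (hf : G.adjMatrix ℝ *ᵥ f = μ • f) : -μ < d := by
  by_contra hμ
  push Not at hμ
  have hadj : ∀ x y, G.Adj x y → f x = -f y := fun x y h => by
    simpa using eq_mul_of_adj_of_eigenvector (s := -1) hreg (by norm_num) hf (by linarith) h
  have hwalk : ∀ x y (w : G.Walk x y), f y = 0 → f x = 0 := by
    intro x y w
    induction w with
    | nil => exact id
    | cons h _ ih => intro h0; rw [hadj _ _ h, ih h0, neg_zero]
  obtain ⟨x, hx⟩ := Function.ne_iff.mp hf0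
  have hne : ∀ y, f y ≠ 0 := fun y hy => hx ((hc.preconnected x y).elim fun w => hwalk x y w hy)
  apply hb
  classical
  -- The sign of `f`, which alternates along edges and never vanishes, is a proper 2-colouring.
  refine ⟨SimpleGraph.Coloring.mk (fun v => if 0 < f v then (0 : Fin 2) else 1) ?_⟩
  intro v w h
  have h1 := hadj v w h
  have h2 := hne v
  have h3 := hne w
  rcases lt_or_gt_of_ne h3 with h4 | h4
  · have : 0 < f v := by linarith
    simp [this, h4.le]
  · have : ¬ 0 < f v := by linarith
    simp [this, h4]

end Spectral

section Classical

open Classical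

variable {V : Type*} [Fintype V] {G : SimpleGraph V} {d : ℕ}

/-- The index of `λ_k` in the eigenvector basis of the adjacency matrix. -/
noncomputable def eigenIndex (V : Type*) [Fintype V] : Fin (Fintype.card V) ≃ V :=
  Fintype.equivOfCardEq (Fintype.card_fin _)

theorem eigenvalues_eigenIndex (k : Fin (Fintype.card V)) :
    (G.isHermitian_adjMatrix ℝ).eigenvalues (eigenIndex V k) =
      (G.isHermitian_adjMatrix ℝ).eigenvalues₀ k := by
  simp [Matrix.IsHermitian.eigenvalues, eigenIndex]

theorem adjEigenvalue_succ (k : Fin (Fintype.card V)) :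
    adjEigenvalue G (k + 1) = (G.isHermitian_adjMatrix ℝ).eigenvalues (eigenIndex V k) := by
  rw [eigenvalues_eigenIndex, adjEigenvalue, dif_pos ⟨by omega, by omega⟩]
  rfl

theorem eigenvectorBasis_ne_zero (j : V) :
    ⇑((G.isHermitian_adjMatrix ℝ).eigenvectorBasis j) ≠ 0 := by
  intro h
  have h1 := (G.isHermitian_adjMatrix ℝ).eigenvectorBasis.orthonormal.1 j
  have h2 : (G.isHermitian_adjMatrix ℝ).eigenvectorBasis j = 0 := by
    ext x
    exact congrFun h x
  rw [h2, norm_zero] at h1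
  exact zero_ne_one h1

theorem eigenvectorBasis_dotProduct {i j : V} (h : i ≠ j) :
    ⇑((G.isHermitian_adjMatrix ℝ).eigenvectorBasis i) ⬝ᵥ
      ⇑((G.isHermitian_adjMatrix ℝ).eigenvectorBasis j) = 0 := by
  have := (G.isHermitian_adjMatrix ℝ).eigenvectorBasis.orthonormal.2 h
  simpa [EuclideanSpace.inner_eq_star_dotProduct, dotProduct_comm] using this

theorem eq_zero_of_forall_eigenvectorBasis_dotProduct {g : V → ℝ}
    (h : ∀ j, ⇑((G.isHermitian_adjMatrix ℝ).eigenvectorBasis j) ⬝ᵥ g = 0) : g = 0 := by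
  have h1 : WithLp.toLp 2 g = (0 : EuclideanSpace ℝ V) := by
    refine InnerProductSpace.ext_inner_left_basis
      (G.isHermitian_adjMatrix ℝ).eigenvectorBasis.toBasis fun j => ?_
    simpa [EuclideanSpace.inner_eq_star_dotProduct, dotProduct_comm] using h j
  simpa using h1

/-- If neither of the first two basis eigenvectors has sum zero, both have eigenvalue `d`, and some
nonzero combination of them has sum zero. This needs no simplicity of the eigenvalue `d`, so it also
applies before connectedness is known. -/
theorem exists_eigenvector_adjEigenvalue_two_le (hreg : G.IsRegularOfDegree d)
    (hcard : 2 ≤ Fintype.card V) :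
    ∃ (f : V → ℝ) (μ : ℝ), f ≠ 0 ∧ ∑ x, f x = 0 ∧ G.adjMatrix ℝ *ᵥ f = μ • f ∧
      adjEigenvalue G 2 ≤ μ := by
  set hA := G.isHermitian_adjMatrix ℝ
  set i : V := eigenIndex V ⟨0, by omega⟩
  set j : V := eigenIndex V ⟨1, by omega⟩
  have hij : i ≠ j := by simp [i, j]
  have h2 : adjEigenvalue G 2 = hA.eigenvalues j :=
    adjEigenvalue_succ (G := G) ⟨1, by omega⟩
  have hle : hA.eigenvalues j ≤ hA.eigenvalues i := by
    rw [eigenvalues_eigenIndex, eigenvalues_eigenIndex]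
    exact hA.eigenvalues₀_antitone (by simp [Fin.le_def])
  have hvi := hA.mulVec_eigenvectorBasis i
  have hvj := hA.mulVec_eigenvectorBasis j
  by_cases hsj : ∑ x, hA.eigenvectorBasis j x = 0
  · exact ⟨_, _, eigenvectorBasis_ne_zero j, hsj, hvj, h2.le⟩
  by_cases hsi : ∑ x, hA.eigenvectorBasis i x = 0
  · exact ⟨_, _, eigenvectorBasis_ne_zero i, hsi, hvi, h2.trans_le hle⟩
  have hdi : hA.eigenvalues i = d := by
    have := sum_eq_zero_of_eigenvector hreg hvi
    have := (mul_eq_zero.mp this).resolve_right hsi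
    linarith
  have hdj : hA.eigenvalues j = d := by
    have := sum_eq_zero_of_eigenvector hreg hvj
    have := (mul_eq_zero.mp this).resolve_right hsj
    linarith
  set a := ∑ x, hA.eigenvectorBasis i x
  set b := ∑ x, hA.eigenvectorBasis j x
  refine ⟨a • ⇑(hA.eigenvectorBasis j) - b • ⇑(hA.eigenvectorBasis i), d, ?_, ?_, ?_, ?_⟩
  · intro h0
    have h1 := congrArg (fun f => f ⬝ᵥ ⇑(hA.eigenvectorBasis j)) h0
    simp only [sub_dotProduct, smul_dotProduct, eigenvectorBasis_dotProduct hij, zero_dotProduct,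
      smul_eq_mul, mul_zero, sub_zero] at h1
    rcases mul_eq_zero.mp h1 with h1 | h1
    · exact hsi h1
    · exact eigenvectorBasis_ne_zero j (dotProduct_self_eq_zero.mp h1)
  · simp only [Pi.sub_apply, Pi.smul_apply, smul_eq_mul, sum_sub_distrib, ← mul_sum]
    change a * b - b * a = 0
    ring
  · rw [mulVec_sub, mulVec_smul, mulVec_smul, hvi, hvj, hdi, hdj, smul_sub, smul_comm a,
      smul_comm b]
  · rw [h2, hdj]

theorem adjEigenvalue_two_le (hreg : G.IsRegularOfDegree d) {θ : ℝ} (hθ : 0 ≤ θ)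
    (h : ∀ (f : V → ℝ) (μ : ℝ), f ≠ 0 → ∑ x, f x = 0 → G.adjMatrix ℝ *ᵥ f = μ • f → μ ≤ θ) :
    adjEigenvalue G 2 ≤ θ := by
  by_cases hcard : 2 ≤ Fintype.card V
  · obtain ⟨f, μ, h0, hs, hf, hle⟩ := exists_eigenvector_adjEigenvalue_two_le hreg hcard
    exact hle.trans (h f μ h0 hs hf)
  -- With fewer than two vertices `adjEigenvalue G 2` has its default value `0`, which is why `0 ≤
  -- θ` is assumed.
  · rw [adjEigenvalue, dif_neg (by omega)]
    exact hθ

/-- A lower bound on the number of walks of length `k` between any two vertices gives a spectral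
gap. -/
theorem adjEigenvalue_two_le_of_pow (hreg : G.IsRegularOfDegree d) {k : ℕ} (hk : 0 < k) {m δ : ℝ}
    (hδ1 : δ ≤ 1) (hm : ∀ y z, m ≤ (G.adjMatrix ℝ ^ k) y z)
    (hδ : δ * (d : ℝ) ^ k ≤ m * Fintype.card V) :
    adjEigenvalue G 2 ≤ (1 - δ / k) * d := by
  have hk1 : (1 : ℝ) ≤ k := by exact_mod_cast hk
  have hδk : δ / k ≤ 1 := by
    rw [div_le_one (by linarith)]
    linarith
  have hnn : 0 ≤ (1 - δ / k) * d := mul_nonneg (by linarith) (Nat.cast_nonneg d)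
  refine adjEigenvalue_two_le hreg hnn fun f μ h0 hs hf => ?_
  have h1 : ∀ x, ∑ y, G.adjMatrix ℝ x y = d := by
    intro x
    simpa [mulVec, dotProduct] using congrFun (adjMatrix_mulVec_one hreg) x
  have h2 := Matrix.abs_eigenvalue_pow_le hm h1 h0 hs hf
  have h3 : |μ| ^ k ≤ ((1 - δ / k) * d) ^ k := by
    calc |μ| ^ k ≤ (1 - δ) * (d : ℝ) ^ k := by linarith
      _ ≤ (1 - δ / k) ^ k * (d : ℝ) ^ k := by
          gcongr
          -- Bernoulli: `1 - δ ≤ (1 - δ / k) ^ k`.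
          have := one_add_mul_le_pow (a := -(δ / k)) (by linarith) k
          have h4 : (k : ℝ) * (δ / k) = δ := by field_simp
          rw [sub_eq_add_neg (1 : ℝ) (δ / k)]
          linarith
      _ = _ := by rw [mul_pow]
  exact (le_abs_self μ).trans (le_of_pow_le_pow_left₀ hk.ne' hnn h3)

theorem spectralGap_pos (hreg : G.IsRegularOfDegree d) (hd : 0 < d) (hc : G.Connected)
    (hb : ¬ G.IsBipartite) : 0 < spectralGap G d := by
  have hcard : 2 ≤ Fintype.card V := by
    obtain ⟨x⟩ := hc.nonempty
    have h1 := G.degree_lt_card_verts x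
    rw [hreg x] at h1
    omega
  have hd' : (0 : ℝ) < d := by exact_mod_cast hd
  rw [spectralGap, sub_pos, div_lt_one hd', lambdaMax, max_lt_iff]
  constructor
  · obtain ⟨f, μ, h0, hs, hf, hle⟩ := exists_eigenvector_adjEigenvalue_two_le hreg hcard
    exact hle.trans_lt (lt_of_connected_of_eigenvector hreg hc h0 hs hf)
  · have h := adjEigenvalue_succ (G := G) ⟨Fintype.card V - 1, by omega⟩
    have h' : Fintype.card V - 1 + 1 = Fintype.card V := by omega
    simp only [h'] at h
    rw [h]
    exact neg_lt_of_not_isBipartite_of_eigenvector hreg hc hb (eigenvectorBasis_ne_zero _)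
      ((G.isHermitian_adjMatrix ℝ).mulVec_eigenvectorBasis _)

/-- An eigenvector basis of a regular graph with spectral gap at least `γ`: one vector is constant,
the other eigenvalues are at most `(1 - γ) d` in absolute value. -/
theorem exists_eigenbasis_of_le_spectralGap (hreg : G.IsRegularOfDegree d) (hd : 0 < d)
    [Nonempty V] {γ : ℝ} (hγ : 0 < γ) (hle : γ ≤ spectralGap G d) :
    ∃ (f : V → V → ℝ) (μ : V → ℝ) (j₀ : V), (∀ j, G.adjMatrix ℝ *ᵥ f j = μ j • f j) ∧
      (∀ g : V → ℝ, (∀ j, f j ⬝ᵥ g = 0) → g = 0) ∧ (∃ c, ∀ x, f j₀ x = c) ∧ μ j₀ = d ∧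
      ∀ j, j ≠ j₀ → |μ j| ≤ (1 - γ) * d := by
  set hA := G.isHermitian_adjMatrix ℝ
  have hd' : (0 : ℝ) < d := by exact_mod_cast hd
  have hn : 0 < Fintype.card V := Fintype.card_pos
  set j₀ : V := eigenIndex V ⟨0, hn⟩
  have hmax : lambdaMax G ≤ (1 - γ) * d := by
    rw [spectralGap] at hle
    rw [← div_le_iff₀ hd']
    linarith
  rw [lambdaMax, max_le_iff] at hmax
  have hbound : ∀ j, j ≠ j₀ → |hA.eigenvalues j| ≤ (1 - γ) * d := by
    intro j hj
    obtain ⟨k, rfl⟩ := (eigenIndex V).surjective j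
    have hk : 1 ≤ (k : ℕ) := by
      by_contra hk
      apply hj
      congr 1
      exact Fin.ext (by simp only; omega)
    have hn1 : 1 < Fintype.card V := by omega
    rw [abs_le]
    constructor
    · have h := adjEigenvalue_succ (G := G) ⟨Fintype.card V - 1, by omega⟩
      have h' : Fintype.card V - 1 + 1 = Fintype.card V := by omega
      simp only [h'] at h
      have h1 : hA.eigenvalues (eigenIndex V ⟨Fintype.card V - 1, by omega⟩) ≤
          hA.eigenvalues (eigenIndex V k) := by
        rw [eigenvalues_eigenIndex, eigenvalues_eigenIndex]
        exact hA.eigenvalues₀_antitone (by rw [Fin.le_def]; simp only; omega)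
      linarith [hmax.2]
    · have h := adjEigenvalue_succ (G := G) ⟨1, hn1⟩
      have h1 : hA.eigenvalues (eigenIndex V k) ≤ hA.eigenvalues (eigenIndex V ⟨1, hn1⟩) := by
        rw [eigenvalues_eigenIndex, eigenvalues_eigenIndex]
        exact hA.eigenvalues₀_antitone (by rw [Fin.le_def]; exact hk)
      exact h1.trans (h.symm.le.trans hmax.1)
  have hone : ∀ j, (hA.eigenvalues j - d) * ∑ x, hA.eigenvectorBasis j x = 0 := fun j =>
    sum_eq_zero_of_eigenvector hreg (hA.mulVec_eigenvectorBasis j)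
  have hsum : ∀ j, j ≠ j₀ → ∑ x, hA.eigenvectorBasis j x = 0 := by
    intro j hj
    refine (mul_eq_zero.mp (hone j)).resolve_left fun h => ?_
    have := (le_abs_self _).trans (hbound j hj)
    nlinarith
  set s := ∑ x, hA.eigenvectorBasis j₀ x
  have hself : ⇑(hA.eigenvectorBasis j₀) ⬝ᵥ ⇑(hA.eigenvectorBasis j₀) = 1 := by
    have := hA.eigenvectorBasis.orthonormal.1 j₀
    rw [EuclideanSpace.norm_eq, Real.sqrt_eq_one] at this
    simpa [dotProduct, sq] using this
  -- The constant function is orthogonal to all other basis vectors, whose eigenvalues differ from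
  -- `d`; so it is a multiple of the vector at `j₀`.
  have hconst : (fun _ => (1 : ℝ)) - s • ⇑(hA.eigenvectorBasis j₀) = 0 := by
    refine eq_zero_of_forall_eigenvectorBasis_dotProduct (G := G) fun j => ?_
    rw [dotProduct_sub, dotProduct_smul, smul_eq_mul]
    by_cases hj : j = j₀
    · subst hj
      rw [hself]
      simp [dotProduct, s]
    · rw [eigenvectorBasis_dotProduct hj]
      simpa [dotProduct] using hsum j hj
  have hval : ∀ x, s * hA.eigenvectorBasis j₀ x = 1 := by
    intro x
    have := congrFun hconst x
    simp only [Pi.sub_apply, Pi.smul_apply, smul_eq_mul, Pi.zero_apply] at this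
    linarith
  have hs0 : s ≠ 0 := by
    rintro hs0
    have := hval (Classical.arbitrary V)
    rw [hs0, zero_mul] at this
    exact zero_ne_one this
  refine ⟨fun j => ⇑(hA.eigenvectorBasis j), hA.eigenvalues, j₀,
    fun j => hA.mulVec_eigenvectorBasis j,
    fun g hg => eq_zero_of_forall_eigenvectorBasis_dotProduct (G := G) hg, ⟨s⁻¹, fun x => ?_⟩, ?_,
    hbound⟩
  · exact eq_inv_of_mul_eq_one_right (hval x)
  · have := (mul_eq_zero.mp (hone j₀)).resolve_right hs0
    linarith

end Classical

/-! ### Spherical functions of the tree -/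

/-- The normalized spherical function of the regular tree: the eigenvalue of the distance-`r`
averaging operator on an eigenvector whose normalized adjacency eigenvalue is `x`, where `θ` is the
inverse of the degree. -/
noncomputable def sphericalValue (θ x : ℝ) : ℕ → ℝ
  | 0 => 1
  | 1 => x
  | r + 2 => (x * sphericalValue θ x (r + 1) - θ * sphericalValue θ x r) / (1 - θ)

section Spherical

variable {θ x : ℝ}

theorem sphericalValue_recurrence (hθ : θ ≤ 1 / 3) (r : ℕ) :
    (1 - θ) * sphericalValue θ x (r + 2) =
      x * sphericalValue θ x (r + 1) - θ * sphericalValue θ x r := by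
  rw [sphericalValue, mul_div_cancel₀]
  linarith

/-- The quadratic form on consecutive values drops at each step by `(1 - 2θ)` times the square of a
difference of values two apart. The drop from radius 0 to radius 1 already yields the gain on the
right. -/
theorem sphericalValue_energy_le (hθ0 : 0 ≤ θ) (hθ : θ ≤ 1 / 3) (r : ℕ) :
    sphericalValue θ x (r + 2) ^ 2 + sphericalValue θ x (r + 1) ^ 2 -
      2 * x * sphericalValue θ x (r + 1) * sphericalValue θ x (r + 2) ≤
      (1 - x ^ 2) - 3 / 4 * (1 - x ^ 2) ^ 2 := by
  induction r with
  | zero =>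
    have h := sphericalValue_recurrence (x := x) hθ 0
    simp only [zero_add] at h ⊢
    set t := sphericalValue θ x 2
    have h1 : sphericalValue θ x 1 = x := rfl
    have h0 : sphericalValue θ x 0 = 1 := rfl
    rw [h1, h0] at h
    rw [h1]
    have ht : (1 - θ) * (t - 1) = x ^ 2 - 1 := by linear_combination h
    have e : t ^ 2 + x ^ 2 - 2 * x * x * t = (1 - x ^ 2) - (1 - 2 * θ) * (t - 1) ^ 2 := by
      linear_combination (2 * (t - 1)) * ht
    rw [e]
    have h2 : (1 - x ^ 2) ^ 2 = (1 - θ) ^ 2 * (t - 1) ^ 2 := by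
      rw [← mul_pow, ht]; ring
    -- The difference of the sides is `(1 - 3θ)(1 + θ) / 4`; equality at `θ = 1/3`, that is `d = 3`,
    -- fixes the constant `3 / 4`.
    have h3 : 3 / 4 * (1 - θ) ^ 2 ≤ 1 - 2 * θ := by nlinarith
    have := mul_le_mul_of_nonneg_right h3 (sq_nonneg (t - 1))
    rw [h2]
    linarith
  | succ r ih =>
    refine le_trans ?_ ih
    have h := sphericalValue_recurrence (x := x) hθ (r + 1)
    have e : r + 1 + 2 = r + 3 := rfl
    have e' : r + 1 + 1 = r + 2 := rfl
    rw [e, e'] at *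
    set a := sphericalValue θ x (r + 1)
    set b := sphericalValue θ x (r + 2)
    set c := sphericalValue θ x (r + 3)
    have : (c ^ 2 + b ^ 2 - 2 * x * b * c) - (b ^ 2 + a ^ 2 - 2 * x * a * b) =
        -((1 - 2 * θ) * (c - a) ^ 2) := by
      linear_combination (2 * (c - a)) * h
    have h2 : 0 ≤ (1 - 2 * θ) * (c - a) ^ 2 := mul_nonneg (by linarith) (sq_nonneg _)
    linarith

theorem sphericalValue_succ_sq_le (hθ0 : 0 ≤ θ) (hθ : θ ≤ 1 / 3) (hx : x ^ 2 < 1) (r : ℕ) :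
    sphericalValue θ x (r + 1) ^ 2 ≤ 1 - 3 / 4 * (1 - x ^ 2) := by
  have h := sphericalValue_energy_le (x := x) hθ0 hθ r
  have hpos : 0 < 1 - x ^ 2 := by linarith
  refine le_of_mul_le_mul_left ?_ hpos
  -- Completing the square: the energy is at least `(1 - x²)` times the square of the value at `r +
  -- 1`.
  nlinarith [sq_nonneg (sphericalValue θ x (r + 2) - x * sphericalValue θ x (r + 1))]

theorem abs_sphericalValue_succ_le (hθ0 : 0 ≤ θ) (hθ : θ ≤ 1 / 3) {γ : ℝ} (hγ : 0 < γ)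
    (hx : |x| ≤ 1 - γ) (r : ℕ) : |sphericalValue θ x (r + 1)| ≤ 1 - 3 / 8 * γ := by
  have hγ1 : γ ≤ 1 := by linarith [abs_nonneg x]
  have hx2 : x ^ 2 ≤ (1 - γ) ^ 2 := sq_le_sq.mpr (by rwa [abs_of_nonneg (by linarith : 0 ≤ 1 - γ)])
  have h := sphericalValue_succ_sq_le hθ0 hθ (x := x) (by nlinarith) r
  refine abs_le_of_sq_le_sq ?_ (by linarith)
  nlinarith

theorem abs_sphericalValue_le_one (hθ0 : 0 ≤ θ) (hθ : θ ≤ 1 / 3) {γ : ℝ} (hγ : 0 < γ)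
    (hx : |x| ≤ 1 - γ) (r : ℕ) : |sphericalValue θ x r| ≤ 1 := by
  cases r with
  | zero => simp [sphericalValue]
  | succ r => linarith [abs_sphericalValue_succ_le hθ0 hθ hγ hx r]

theorem sphericalValue_one (hθ : θ ≤ 1 / 3) (r : ℕ) : sphericalValue θ 1 r = 1 := by
  induction r using Nat.twoStepInduction with
  | zero => rfl
  | one => rfl
  | more r h0 h1 =>
    have h := sphericalValue_recurrence (x := 1) hθ r
    rw [h0, h1] at h
    have h2 : (1 - θ) ≠ 0 := by linarith
    exact mul_left_cancel₀ h2 (by linarith)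

end Spherical

/-! ### Arrangements of the distances -/

/-- The sequences with entries `p`, `q`, `p + q` in some order. -/
def arrangements (p q : ℕ) : Finset (Fin 3 → ℕ) :=
  univ.image fun π : Equiv.Perm (Fin 3) => ![p, q, p + q] ∘ π

section Arrangements

variable {p q : ℕ}

theorem mem_arrangements_iff_exists {u : Fin 3 → ℕ} :
    u ∈ arrangements p q ↔ ∃ π : Equiv.Perm (Fin 3), ![p, q, p + q] ∘ π = u := by
  simp [arrangements]

theorem comp_perm_mem_arrangements (π : Equiv.Perm (Fin 3)) {u : Fin 3 → ℕ}
    (hu : u ∈ arrangements p q) : u ∘ π ∈ arrangements p q := by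
  rw [mem_arrangements_iff_exists] at hu ⊢
  obtain ⟨π', rfl⟩ := hu
  exact ⟨π' * π, rfl⟩

theorem sum_arrangements_comp_perm {M : Type*} [AddCommMonoid M] (π : Equiv.Perm (Fin 3))
    (F : (Fin 3 → ℕ) → M) :
    ∑ u ∈ arrangements p q, F (u ∘ π) = ∑ u ∈ arrangements p q, F u := by
  refine sum_nbij' (fun u => u ∘ π) (fun u => u ∘ π.symm)
    (fun u hu => comp_perm_mem_arrangements π hu)
    (fun u hu => comp_perm_mem_arrangements π.symm hu) ?_ ?_ fun u _ => rfl
  · intro u _; ext i; simp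
  · intro u _; ext i; simp

theorem prod_of_mem_arrangements {M : Type*} [CommMonoid M] (g : ℕ → M) {u : Fin 3 → ℕ}
    (hu : u ∈ arrangements p q) : ∏ i, g (u i) = g p * g q * g (p + q) := by
  obtain ⟨π, rfl⟩ := mem_arrangements_iff_exists.mp hu
  simp only [Function.comp_apply]
  rw [Equiv.prod_comp π fun i => g (![p, q, p + q] i), Fin.prod_univ_three]
  rfl

theorem sum_of_mem_arrangements {u : Fin 3 → ℕ} (hu : u ∈ arrangements p q) :
    ∑ i, u i = 2 * (p + q) := by
  obtain ⟨π, rfl⟩ := mem_arrangements_iff_exists.mp hu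
  simp only [Function.comp_apply]
  rw [Equiv.sum_comp π fun i => ![p, q, p + q] i, Fin.sum_univ_three]
  simp
  ring

theorem apply_of_mem_arrangements {u : Fin 3 → ℕ} (hu : u ∈ arrangements p q) (i : Fin 3) :
    u i = p ∨ u i = q ∨ u i = p + q := by
  obtain ⟨π, rfl⟩ := mem_arrangements_iff_exists.mp hu
  simp only [Function.comp_apply]
  generalize π i = j
  fin_cases j <;> simp

theorem arrangements_cases {u : Fin 3 → ℕ}
    (h : univ.val.map u = ({p, q, p + q} : Multiset ℕ)) :
    u = ![p, q, p + q] ∨ u = ![p, p + q, q] ∨ u = ![q, p, p + q] ∨ u = ![q, p + q, p] ∨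
      u = ![p + q, p, q] ∨ u = ![p + q, q, p] := by
  have hu : u = ![u 0, u 1, u 2] := by ext i; fin_cases i <;> rfl
  have h' : [u 0, u 1, u 2] ∈ [p, q, p + q].permutations :=
    List.mem_permutations.mpr (Multiset.coe_eq_coe.mp h)
  generalize p + q = r at *
  simp only [List.permutations, List.permutationsAux, List.permutationsAux.rec,
    List.permutationsAux2, id_eq, List.foldr_cons, List.foldr_nil,
    List.mem_cons, List.cons.injEq, and_true, List.not_mem_nil, or_false] at h'
  rcases h' with ⟨h0, h1, h2⟩ | ⟨h0, h1, h2⟩ | ⟨h0, h1, h2⟩ | ⟨h0, h1, h2⟩ | ⟨h0, h1, h2⟩ |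
    ⟨h0, h1, h2⟩ <;> rw [hu, h0, h1, h2] <;> simp

theorem mem_arrangements_of_eq {u : Fin 3 → ℕ} (h : u = ![p, q, p + q] ∨ u = ![p, p + q, q] ∨
    u = ![q, p, p + q] ∨ u = ![q, p + q, p] ∨ u = ![p + q, p, q] ∨ u = ![p + q, q, p]) :
    u ∈ arrangements p q := by
  rw [mem_arrangements_iff_exists]
  rcases h with h | h | h | h | h | h
  · exact ⟨1, h.symm⟩
  · exact ⟨Equiv.swap 1 2, by rw [h]; ext i; fin_cases i <;> rfl⟩
  · exact ⟨Equiv.swap 0 1, by rw [h]; ext i; fin_cases i <;> rfl⟩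
  · exact ⟨finRotate 3, by rw [h]; ext i; fin_cases i <;> rfl⟩
  · exact ⟨(finRotate 3).symm, by rw [h]; ext i; fin_cases i <;> rfl⟩
  · exact ⟨Equiv.swap 0 2, by rw [h]; ext i; fin_cases i <;> rfl⟩

theorem mem_arrangements_iff {u : Fin 3 → ℕ} :
    u ∈ arrangements p q ↔ univ.val.map u = ({p, q, p + q} : Multiset ℕ) := by
  rw [mem_arrangements_iff_exists]
  constructor
  · rintro ⟨π, rfl⟩
    rw [← Multiset.map_map, Multiset.map_univ_val_equiv π]
    rfl
  · exact fun h => mem_arrangements_iff_exists.mp (mem_arrangements_of_eq (arrangements_cases h))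

theorem polygraph_adj_iff {V : Type*} {G : SimpleGraph V} (hpq : p < q) {x y : Fin 3 → V} :
    (polygraph G {p, q, p + q}).Adj x y ↔ (fun i => G.dist (x i) (y i)) ∈ arrangements p q := by
  rw [mem_arrangements_iff]
  refine ⟨fun h => h.2, fun h => ⟨?_, h⟩⟩
  rintro rfl
  -- If `x = y` all distances are `0`, but `q > p ≥ 0` has to occur among them.
  have : q ∈ ({p, q, p + q} : Multiset ℕ) := by simp
  rw [← h] at this
  simp at this
  omega

end Arrangements

/-! ### Degrees and product eigenvectors of the polygraph -/

/-- The degree of the polygraph `G_{[p,q,p+q]}` of a `d`-regular graph of large girth. -/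
def polygraphDegree (p q d : ℕ) : ℕ :=
  ∑ u ∈ arrangements p q, ∏ i, triangleCount d 0 (u i) (u i)

/-- The degree of the links of the polygraph `G_{[p,q,p+q]}` of a `d`-regular graph of large
girth. -/
def polygraphLinkDegree (p q d : ℕ) : ℕ :=
  ∑ τ ∈ arrangements p q, ∑ υ ∈ arrangements p q,
    ∏ i, triangleCount d (![p, q, p + q] i) (τ i) (υ i)

section Polygraph

variable {V : Type*} [Fintype V] {G : SimpleGraph V} {p q d R : ℕ}

theorem sum_arrangements_fiberwise {ι M : Type*} [Fintype ι] [AddCommMonoid M]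
    (g : ι → Fin 3 → ℕ) (F : ι → M) :
    ∑ y with g y ∈ arrangements p q, F y =
      ∑ u ∈ arrangements p q, ∑ y with (∀ i, g y i = u i), F y := by
  rw [← sum_fiberwise_of_maps_to (g := g) (t := arrangements p q) (by simp)]
  refine sum_congr rfl fun u hu => sum_congr ?_ fun _ _ => rfl
  ext y
  simp only [mem_filter, mem_univ, true_and, ← funext_iff]
  exact ⟨fun h => h.2, fun h => ⟨h ▸ hu, h⟩⟩

theorem IsTreeLike.card_sphere (hT : IsTreeLike G R) (hc : G.Connected)
    (hreg : ∀ v, #{w | G.dist v w = 1} = d) (x : V) {r : ℕ} (hr : r ≤ R) :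
    #{z | G.dist x z = r} = triangleCount d 0 r r := by
  rw [← hT.card_triangle hc hreg (x := x) (y := x) (by simp) ⟨r, by omega⟩ (by omega)]
  simp

open Classical in
theorem card_polygraph_neighbors (hT : IsTreeLike G R) (hc : G.Connected)
    (hreg : ∀ v, #{w | G.dist v w = 1} = d) (hpq : p < q) (hR : p + q ≤ R) (x : Fin 3 → V) :
    #{y | (polygraph G {p, q, p + q}).Adj x y} = polygraphDegree p q d := by
  simp_rw [polygraph_adj_iff hpq]
  rw [card_eq_sum_ones, sum_arrangements_fiberwise, polygraphDegree]
  refine sum_congr rfl fun u hu => ?_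
  rw [← card_eq_sum_ones]
  have : ({y | ∀ i, G.dist (x i) (y i) = u i} : Finset (Fin 3 → V)) =
      Fintype.piFinset fun i => ({v | G.dist (x i) v = u i} : Finset V) := by
    ext y; simp
  rw [this, Fintype.card_piFinset]
  refine prod_congr rfl fun i _ => hT.card_sphere hc hreg _ ?_
  have := apply_of_mem_arrangements hu i
  omega

open Classical in
theorem card_polygraph_common_neighbors (hT : IsTreeLike G R) (hc : G.Connected)
    (hreg : ∀ v, #{w | G.dist v w = 1} = d) (hp : Even p) (hq : Even q) (hpq : p < q)
    (hR : 3 * (p + q) ≤ 2 * R) {x y : Fin 3 → V} (hxy : (polygraph G {p, q, p + q}).Adj x y) :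
    #{z | (polygraph G {p, q, p + q}).Adj x z ∧ (polygraph G {p, q, p + q}).Adj y z} =
      polygraphLinkDegree p q d := by
  rw [polygraph_adj_iff hpq] at hxy
  have hparity : ∀ u ∈ arrangements p q, ∀ i, Even (u i) ∧ u i ≤ p + q := by
    intro u hu i
    rcases apply_of_mem_arrangements hu i with h | h | h <;> rw [h]
    · exact ⟨hp, by omega⟩
    · exact ⟨hq, by omega⟩
    · exact ⟨hp.add hq, le_rfl⟩
  have h1 : #{z | (polygraph G {p, q, p + q}).Adj x z ∧ (polygraph G {p, q, p + q}).Adj y z} =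
      ∑ τ ∈ arrangements p q, ∑ υ ∈ arrangements p q,
        ∏ i, triangleCount d (G.dist (x i) (y i)) (τ i) (υ i) := by
    simp_rw [polygraph_adj_iff hpq]
    rw [← filter_filter, card_eq_sum_ones, sum_filter, sum_arrangements_fiberwise]
    refine sum_congr rfl fun τ hτ => ?_
    rw [← sum_filter, filter_filter]
    simp_rw [and_comm (a := ∀ i, G.dist (x i) _ = τ i)]
    rw [← filter_filter, sum_filter, sum_arrangements_fiberwise]
    refine sum_congr rfl fun υ hυ => ?_
    rw [← sum_filter, filter_filter, ← card_eq_sum_ones]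
    have : ({z | (∀ i, G.dist (y i) (z i) = υ i) ∧ ∀ i, G.dist (x i) (z i) = τ i} :
        Finset (Fin 3 → V)) = Fintype.piFinset fun i =>
          ({v | G.dist (x i) v = τ i ∧ G.dist (y i) v = υ i} : Finset V) := by
      ext y; simp only [mem_filter, mem_univ, true_and, Fintype.mem_piFinset]; grind
    rw [this, Fintype.card_piFinset]
    refine prod_congr rfl fun i _ => ?_
    have a1 := hparity _ hxy i
    have a2 := hparity τ hτ i
    have a3 := hparity υ hυ i
    exact hT.card_triangle hc hreg rfl ((a1.1.add a2.1).add a3.1) (by omega)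
  rw [h1, polygraphLinkDegree]
  -- Permuting coordinates reduces the distances from `x` to `y` to the standard order, so the count
  -- does not depend on the edge.
  obtain ⟨π, hπ⟩ := mem_arrangements_iff_exists.mp hxy
  rw [← sum_arrangements_comp_perm π]
  refine sum_congr rfl fun τ _ => ?_
  rw [← sum_arrangements_comp_perm π]
  refine sum_congr rfl fun υ _ => ?_
  rw [← Equiv.prod_comp π fun i => triangleCount d (![p, q, p + q] i) (τ i) (υ i)]
  refine prod_congr rfl fun i _ => ?_
  have := congrFun hπ i
  simp only [Function.comp_apply] at this ⊢
  rw [this]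

/-- Distance sums of an eigenvector are multiples of the eigenvector. -/
theorem IsTreeLike.sum_sphere_eigenvector (hT : IsTreeLike G R) (hc : G.Connected)
    (hreg : ∀ v, #{w | G.dist v w = 1} = d) (hd : 3 ≤ d) {f : V → ℝ} {μ : ℝ}
    (hf : ∀ w, ∑ z with G.dist w z = 1, f z = μ * f w) (x : V) {r : ℕ} (hr : r ≤ R) :
    ∑ y with G.dist x y = r, f y =
      triangleCount d 0 r r * sphericalValue (d : ℝ)⁻¹ (μ / d) r * f x := by
  have hd0 : (d : ℝ) ≠ 0 := by positivity
  have hrec : ∀ r, r + 2 ≤ R → μ * ∑ y with G.dist x y = r + 1, f y =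
      ∑ y with G.dist x y = r + 2, f y +
        triangleCount d r (r + 1) 1 * ∑ y with G.dist x y = r, f y := by
    intro r hr
    rw [mul_sum]
    simp_rw [← hf]
    -- Exchanging the sums weights each `f z` by the number of neighbours of `z` on the sphere of
    -- radius `r + 1`: one for radius `r + 2`, the number of children for radius `r`, none
    -- otherwise.
    rw [sum_comm' (t' := univ) (s' := fun z => {w | G.dist x w = r + 1 ∧ G.dist z w = 1})
      (by intro w z; simp [G.dist_comm])]
    rw [mul_sum, sum_filter, sum_filter, ← sum_add_distrib]
    refine sum_congr rfl fun z _ => ?_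
    rw [sum_const, nsmul_eq_mul]
    rcases lt_trichotomy (G.dist x z) (r + 1) with h | h | h
    · rw [if_neg (by omega), zero_add]
      by_cases h' : G.dist x z = r
      · rw [if_pos h', hT.card_triangle hc hreg h' ⟨r + 1, by omega⟩ (by omega)]
      · rw [if_neg h', card_eq_zero.mpr, Nat.cast_zero, zero_mul]
        rw [filter_eq_empty_iff]
        rintro w - ⟨h1, h2⟩
        have := dist_le_dist_add_one hc x (SimpleGraph.dist_eq_one_iff_adj.mp h2)
        omega
    · rw [if_neg (by omega), if_neg (by omega), card_eq_zero.mpr, Nat.cast_zero, zero_mul,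
        zero_add]
      rw [filter_eq_empty_iff]
      rintro w - ⟨h1, h2⟩
      exact hT.dist_ne (by omega) (SimpleGraph.dist_eq_one_iff_adj.mp h2) (h1.trans h.symm)
    · rw [if_neg (by omega : ¬ G.dist x z = r), add_zero]
      by_cases h' : G.dist x z = r + 2
      · rw [if_pos h', hT.card_triangle hc hreg h' ⟨r + 2, by omega⟩ (by omega)]
        have : triangleCount d (r + 2) (r + 1) 1 = 1 := by
          rw [triangleCount, if_pos (by omega), tripodCount, if_pos (by omega)]
        rw [this, Nat.cast_one, one_mul]
      · rw [if_neg h', card_eq_zero.mpr, Nat.cast_zero, zero_mul]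
        rw [filter_eq_empty_iff]
        rintro w - ⟨h1, h2⟩
        have := dist_le_dist_add_one hc x (SimpleGraph.dist_eq_one_iff_adj.mp h2)
        omega
  have hs : ∀ r, triangleCount d 0 (r + 1) (r + 1) = d * (d - 1) ^ r := by
    intro r
    rw [triangleCount, if_pos (by omega)]
    have e1 : (r + 1 + (r + 1) - 0) / 2 = r + 1 := by omega
    have e2 : (0 + (r + 1) - (r + 1)) / 2 = 0 := by omega
    rw [e1, e2]
    simp [tripodCount]
  have hs0 : triangleCount d 0 0 0 = 1 := by simp [triangleCount, tripodCount]
  have hn : ∀ r, triangleCount d r (r + 1) 1 * triangleCount d 0 r r =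
      triangleCount d 0 (r + 1) (r + 1) := by
    intro r
    have e1 : (r + (r + 1) - 1) / 2 = r := by omega
    have e2 : (r + 1 - (r + 1)) / 2 = 0 := by omega
    have e3 : (r + 1 + 1 - r) / 2 = 1 := by omega
    rw [hs, triangleCount, if_pos (by omega), e1, e2, e3]
    cases r with
    | zero => simp [tripodCount, hs0]
    | succ r => rw [hs]; simp [tripodCount]; ring
  induction r using Nat.twoStepInduction with
  | zero =>
    have : ({y | G.dist x y = 0} : Finset V) = {x} := by
      ext y
      simp [hc.dist_eq_zero_iff, eq_comm]
    rw [this, hs0]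
    simp [sphericalValue]
  | one =>
    rw [hf, hs 0, pow_zero, mul_one, sphericalValue, mul_div_cancel₀ _ hd0]
  | more r h0 h1 =>
    have h := hrec r hr
    rw [h0 (by omega), h1 (by omega)] at h
    have hθ : (d : ℝ)⁻¹ ≤ 1 / 3 := by
      rw [one_div]
      gcongr
      exact_mod_cast hd
    have ht := sphericalValue_recurrence (x := μ / d) hθ r
    have hn' : (triangleCount d r (r + 1) 1 : ℝ) * triangleCount d 0 r r =
      triangleCount d 0 (r + 1) (r + 1) := by exact_mod_cast hn r
    have hD : (triangleCount d 0 (r + 2) (r + 2) : ℝ) =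
        triangleCount d 0 (r + 1) (r + 1) * (d - 1) := by
      rw [hs, hs]
      push_cast [Nat.cast_sub (by omega : 1 ≤ d)]
      ring
    rw [hD]
    set t0 := sphericalValue (d : ℝ)⁻¹ (μ / d) r
    set t1 := sphericalValue (d : ℝ)⁻¹ (μ / d) (r + 1)
    set t2 := sphericalValue (d : ℝ)⁻¹ (μ / d) (r + 2)
    have ht' : (d - 1) * t2 = μ * t1 - t0 := by
      field_simp at ht
      linear_combination ht
    linear_combination (-1 : ℝ) * h - t0 * f x * hn' -
      triangleCount d 0 (r + 1) (r + 1) * f x * ht'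

end Polygraph

/-! ### Sizes of the counts in powers of `h = √(d-1)` -/

/-- Side lengths of a triangle in a tree, of perimeter at most `2 * R`. -/
structure IsTreeTriangle (R i j k : ℕ) : Prop where
  even : Even (i + j + k)
  perimeter_le : i + j + k ≤ 2 * R
  le₁ : i ≤ j + k
  le₂ : j ≤ i + k
  le₃ : k ≤ i + j

section Bounds

variable {d R : ℕ}

theorem tripodCount_bounds (hd : 3 ≤ d) (α β κ : ℕ) :
    (d - 1) ^ κ ≤ 2 * tripodCount d α β κ ∧ tripodCount d α β κ ≤ 2 * (d - 1) ^ κ := by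
  cases κ with
  | zero => simp [tripodCount]
  | succ κ =>
    rw [tripodCount, if_neg (by omega), Nat.add_sub_cancel, pow_succ', ← mul_assoc, ← mul_assoc]
    constructor <;> refine Nat.mul_le_mul_right _ ?_ <;> split_ifs <;> omega

variable {h : ℝ}

/-- The count is about `(d-1)^κ = h^(2κ)` with `2κ = j + k - i`. The factor `h ^ i` is moved to the
other side to avoid subtraction of exponents. -/
theorem le_triangleCount (hd : 3 ≤ d) (hh : h ^ 2 = (d - 1 : ℕ)) (h0 : 0 < h) {i j k : ℕ}
    (ht : IsTreeTriangle R i j k) : h ^ (j + k) ≤ 2 * (h ^ i * triangleCount d i j k) := by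
  rw [triangleCount, if_pos ⟨ht.le₁, ht.le₂, ht.le₃⟩]
  have hκ : j + k = i + 2 * ((j + k - i) / 2) := by
    obtain ⟨m, hm⟩ := ht.even
    have := ht.le₁
    omega
  have hb := (tripodCount_bounds hd ((i + j - k) / 2) ((i + k - j) / 2) ((j + k - i) / 2)).1
  set t := tripodCount d ((i + j - k) / 2) ((i + k - j) / 2) ((j + k - i) / 2)
  have hb' : ((d - 1 : ℕ) : ℝ) ^ ((j + k - i) / 2) ≤ 2 * t := by exact_mod_cast hb
  rw [← hh, ← pow_mul] at hb'
  calc h ^ (j + k) = h ^ i * h ^ (2 * ((j + k - i) / 2)) := by rw [← pow_add, ← hκ]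
    _ ≤ h ^ i * (2 * t) := by gcongr
    _ = _ := by ring

theorem triangleCount_le (hd : 3 ≤ d) (hh : h ^ 2 = (d - 1 : ℕ)) (h0 : 0 < h) {i j k : ℕ}
    (heven : Even (i + j + k)) : h ^ i * triangleCount d i j k ≤ 2 * h ^ (j + k) := by
  rw [triangleCount]
  split_ifs with ht
  · have hκ : j + k = i + 2 * ((j + k - i) / 2) := by
      obtain ⟨m, hm⟩ := heven
      omega
    have hb := (tripodCount_bounds hd ((i + j - k) / 2) ((i + k - j) / 2) ((j + k - i) / 2)).2
    set t := tripodCount d ((i + j - k) / 2) ((i + k - j) / 2) ((j + k - i) / 2)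
    have hb' : (t : ℝ) ≤ 2 * ((d - 1 : ℕ) : ℝ) ^ ((j + k - i) / 2) := by exact_mod_cast hb
    rw [← hh, ← pow_mul] at hb'
    calc h ^ i * t ≤ h ^ i * (2 * h ^ (2 * ((j + k - i) / 2))) := by gcongr
      _ = 2 * h ^ (j + k) := by
          rw [mul_left_comm, ← pow_add, ← hκ]
  · simp only [Nat.cast_zero, mul_zero]
    positivity

variable {p q : ℕ}

theorem even_of_mem_arrangements (hp : Even p) (hq : Even q) {u : Fin 3 → ℕ}
    (hu : u ∈ arrangements p q) (i : Fin 3) : Even (u i) := by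
  rcases apply_of_mem_arrangements hu i with h | h | h <;> rw [h]
  exacts [hp, hq, hp.add hq]

theorem base_mem_arrangements : ![p, q, p + q] ∈ arrangements p q :=
  mem_arrangements_iff_exists.mpr ⟨1, rfl⟩

theorem prod_pow_of_mem_arrangements {u : Fin 3 → ℕ} (hu : u ∈ arrangements p q) :
    ∏ i, h ^ u i = h ^ (2 * (p + q)) := by
  rw [prod_pow_eq_pow_sum, sum_of_mem_arrangements hu]

/-- Each of the `#(arrangements p q) ^ 2` terms is at most `2 ^ 3` times `h` to the sum of all `τ i
+ υ i` minus the base distances, and every arrangement sums to `2(p+q)`. -/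
theorem polygraphLinkDegree_le (hp : Even p) (hq : Even q) (hd : 3 ≤ d)
    (hh : h ^ 2 = (d - 1 : ℕ)) (h0 : 0 < h) :
    (polygraphLinkDegree p q d : ℝ) ≤ 8 * #(arrangements p q) ^ 2 * h ^ (2 * (p + q)) := by
  have hterm : ∀ τ ∈ arrangements p q, ∀ υ ∈ arrangements p q,
      ((∏ i, triangleCount d (![p, q, p + q] i) (τ i) (υ i) : ℕ) : ℝ) ≤
        8 * h ^ (2 * (p + q)) := by
    intro τ hτ υ hυ
    have hpos : 0 < h ^ (2 * (p + q)) := by positivity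
    refine le_of_mul_le_mul_left ?_ hpos
    calc h ^ (2 * (p + q)) * ((∏ i, triangleCount d (![p, q, p + q] i) (τ i) (υ i) : ℕ) : ℝ)
        = ∏ i, h ^ (![p, q, p + q] i) * triangleCount d (![p, q, p + q] i) (τ i) (υ i) := by
          rw [prod_mul_distrib, prod_pow_of_mem_arrangements base_mem_arrangements]
          push_cast
          rfl
      _ ≤ ∏ i, 2 * h ^ (τ i + υ i) := by
          refine prod_le_prod (fun i _ => by positivity) fun i _ => ?_
          exact triangleCount_le hd hh h0
            (((even_of_mem_arrangements hp hq base_mem_arrangements i).add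
              (even_of_mem_arrangements hp hq hτ i)).add (even_of_mem_arrangements hp hq hυ i))
      _ = h ^ (2 * (p + q)) * (8 * h ^ (2 * (p + q))) := by
          simp_rw [pow_add _ (τ _), prod_mul_distrib, prod_pow_of_mem_arrangements hτ,
            prod_pow_of_mem_arrangements hυ, prod_const, card_univ, Fintype.card_fin]
          ring
  rw [polygraphLinkDegree]
  push_cast
  push_cast at hterm
  calc _ ≤ ∑ τ ∈ arrangements p q, ∑ υ ∈ arrangements p q, 8 * h ^ (2 * (p + q)) :=
        sum_le_sum fun τ hτ => sum_le_sum fun υ hυ => hterm τ hτ υ hυ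
    _ = _ := by
        simp only [sum_const, nsmul_eq_mul]
        ring

theorem le_polygraphDegree (hd : 3 ≤ d) (hh : h ^ 2 = (d - 1 : ℕ)) (h0 : 0 < h) :
    h ^ (4 * (p + q)) ≤ 8 * polygraphDegree p q d := by
  have hle : ∏ i, triangleCount d 0 (![p, q, p + q] i) (![p, q, p + q] i) ≤
      polygraphDegree p q d :=
    single_le_sum (f := fun u : Fin 3 → ℕ => ∏ i, triangleCount d 0 (u i) (u i))
      (fun _ _ => Nat.zero_le _) base_mem_arrangements
  have hle' : (∏ i, (triangleCount d 0 (![p, q, p + q] i) (![p, q, p + q] i) : ℝ)) ≤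
      polygraphDegree p q d := by exact_mod_cast hle
  calc h ^ (4 * (p + q)) = ∏ i, h ^ (![p, q, p + q] i + ![p, q, p + q] i) := by
        simp_rw [pow_add, prod_mul_distrib, prod_pow_of_mem_arrangements base_mem_arrangements]
        ring
    _ ≤ ∏ i, 2 * (h ^ 0 * (triangleCount d 0 (![p, q, p + q] i) (![p, q, p + q] i) : ℝ)) := by
        refine prod_le_prod (fun i _ => by positivity) fun i _ => ?_
        exact le_triangleCount (R := ![p, q, p + q] i) hd hh h0
          ⟨⟨![p, q, p + q] i, by omega⟩, by omega, by omega, by omega, by omega⟩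
    _ = 8 * ∏ i, (triangleCount d 0 (![p, q, p + q] i) (![p, q, p + q] i) : ℝ) := by
        simp_rw [pow_zero, one_mul, prod_mul_distrib, prod_const, card_univ, Fintype.card_fin]
        norm_num
    _ ≤ _ := by gcongr

end Bounds

/-! ### Spreading of walks in one coordinate -/

section Steps

variable {V : Type*} {G : SimpleGraph V} {d R : ℕ} {h : ℝ}

/-- The transition matrix of moves of length `s.1` that end at distance `s.2` from `o`. -/
noncomputable def stepMatrix (G : SimpleGraph V) (o : V) (s : ℕ × ℕ) : Matrix V V ℝ :=
  Matrix.of fun y w => if G.dist o w = s.2 ∧ G.dist y w = s.1 then 1 else 0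

theorem stepMatrix_nonneg (o : V) (s : ℕ × ℕ) (y w : V) : 0 ≤ stepMatrix G o s y w := by
  rw [stepMatrix, of_apply]
  split_ifs <;> simp

/-- The entries of `M` between the spheres of radii `s` and `t` about `o` are, up to the constant
`c`, at least the average for a walk of total length `U`. -/
structure IsSpread (G : SimpleGraph V) (h : ℝ) (o : V) (c : ℝ) (s t U : ℕ)
    (M : Matrix V V ℝ) : Prop where
  nonneg : ∀ y z, 0 ≤ M y z
  le : ∀ y z, G.dist o y = s → G.dist o z = t → c * h ^ U ≤ h ^ (s + t) * M y z

variable [Fintype V]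

theorem Matrix.mul_nonneg_apply {M N : Matrix V V ℝ} (hM : ∀ y z, 0 ≤ M y z)
    (hN : ∀ y z, 0 ≤ N y z) (y z : V) : 0 ≤ (M * N) y z := by
  rw [mul_apply]
  exact sum_nonneg fun w _ => mul_nonneg (hM y w) (hN w z)

/-- A move of length `s + t` between the spheres of radii `s` and `t` goes through `o`. Any point of
radius `t` in a branch avoiding both `y` and `z` can therefore be the midpoint, whatever `y` and `z`
are; such points make up a fixed proportion. -/
theorem isSpread_cross (hT : IsTreeLike G R) (hc : G.Connected)
    (hreg : ∀ v, #{w | G.dist v w = 1} = d) (hd : 3 ≤ d) (hh : h ^ 2 = (d - 1 : ℕ)) (h0 : 0 < h)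
    (o : V) {s s' t : ℕ} (hR : s + t ≤ R) (hR' : s' + t ≤ R) :
    IsSpread G h o (1 / 2) s s' (s + t + (s' + t))
      (stepMatrix G o (s + t, t) * stepMatrix G o (s' + t, s')) := by
  refine ⟨mul_nonneg_apply (stepMatrix_nonneg o _) (stepMatrix_nonneg o _), ?_⟩
  intro y z hy hz
  have hcard := hT.card_opposite hc hreg hd hy hz hR hR'
  have hM : (stepMatrix G o (s + t, t) * stepMatrix G o (s' + t, s')) y z =
      #{w | G.dist o w = t ∧ G.dist y w = s + t ∧ G.dist z w = s' + t} := by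
    rw [mul_apply, ← sum_boole]
    refine sum_congr rfl fun w _ => ?_
    simp only [stepMatrix, of_apply, hz, true_and, G.dist_comm (u := w), mul_ite, mul_one,
      mul_zero]
    split_ifs <;> first | rfl | tauto
  rw [hM]
  set n := #{w | G.dist o w = t ∧ G.dist y w = s + t ∧ G.dist z w = s' + t}
  have hn : ((d - 1 : ℕ) : ℝ) ^ t ≤ 2 * n := by exact_mod_cast hcard
  rw [← hh, ← pow_mul] at hn
  calc 1 / 2 * h ^ (s + t + (s' + t)) = h ^ (s + s') * (1 / 2 * h ^ (2 * t)) := by ring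
    _ ≤ h ^ (s + s') * n := by gcongr; linarith

/-- A further move averages an already spread distribution, so only the factor 2 of
`le_triangleCount` is lost. `IsSpread.stepMatrix_mul` is the same for a move made beforehand. -/
theorem IsSpread.mul_stepMatrix (hT : IsTreeLike G R) (hc : G.Connected)
    (hreg : ∀ v, #{w | G.dist v w = 1} = d) (hd : 3 ≤ d) (hh : h ^ 2 = (d - 1 : ℕ)) (h0 : 0 < h)
    {o : V} {c : ℝ} (hc0 : 0 ≤ c) {s t U : ℕ} {M : Matrix V V ℝ}
    (hM : IsSpread G h o c s t U M) {u t' : ℕ} (ht : IsTreeTriangle R t' t u) :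
    IsSpread G h o (c / 2) s t' (U + u) (M * stepMatrix G o (u, t')) := by
  refine ⟨mul_nonneg_apply hM.nonneg (stepMatrix_nonneg o _), ?_⟩
  intro y z hy hz
  have hcard := hT.card_triangle hc hreg hz (by simpa [G.dist_comm] using ht.even)
    ht.perimeter_le
  have hlow := le_triangleCount hd hh h0 ht
  rw [← hcard] at hlow
  set S : Finset V := {w | G.dist o w = t ∧ G.dist z w = u}
  have hsum : ∑ w ∈ S, M y w ≤ (M * stepMatrix G o (u, t')) y z := by
    rw [mul_apply, sum_filter]
    refine sum_le_sum fun w _ => ?_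
    split_ifs with hw
    · rw [stepMatrix, of_apply, if_pos ⟨hz, by rw [G.dist_comm]; exact hw.2⟩, mul_one]
    · exact mul_nonneg (hM.nonneg y w) (stepMatrix_nonneg o _ w z)
  have hS : #S * (c * h ^ U) ≤ h ^ (s + t) * ∑ w ∈ S, M y w := by
    rw [mul_sum, ← nsmul_eq_mul, ← sum_const]
    refine sum_le_sum fun w hw => hM.le y w hy ?_
    simp only [S, mem_filter] at hw
    exact hw.2.1
  have hpos : 0 < h ^ t := by positivity
  refine le_of_mul_le_mul_left ?_ hpos
  calc h ^ t * (c / 2 * h ^ (U + u)) = c / 2 * h ^ U * h ^ (t + u) := by ring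
    _ ≤ c / 2 * h ^ U * (2 * (h ^ t' * #S)) := by gcongr
    _ = h ^ t' * (#S * (c * h ^ U)) := by ring
    _ ≤ h ^ t' * (h ^ (s + t) * ∑ w ∈ S, M y w) := by gcongr
    _ ≤ h ^ t' * (h ^ (s + t) * (M * stepMatrix G o (u, t')) y z) := by gcongr
    _ = _ := by ring

theorem IsSpread.stepMatrix_mul (hT : IsTreeLike G R) (hc : G.Connected)
    (hreg : ∀ v, #{w | G.dist v w = 1} = d) (hd : 3 ≤ d) (hh : h ^ 2 = (d - 1 : ℕ)) (h0 : 0 < h)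
    {o : V} {c : ℝ} (hc0 : 0 ≤ c) {s t U : ℕ} {M : Matrix V V ℝ}
    (hM : IsSpread G h o c s t U M) {u s' : ℕ} (ht : IsTreeTriangle R s' s u) :
    IsSpread G h o (c / 2) s' t (u + U) (stepMatrix G o (u, s) * M) := by
  refine ⟨mul_nonneg_apply (stepMatrix_nonneg o _) hM.nonneg, ?_⟩
  intro y z hy hz
  have hcard := hT.card_triangle hc hreg hy ht.even ht.perimeter_le
  have hlow := le_triangleCount hd hh h0 ht
  rw [← hcard] at hlow
  set S : Finset V := {w | G.dist o w = s ∧ G.dist y w = u}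
  have hsum : ∑ w ∈ S, M w z = (stepMatrix G o (u, s) * M) y z := by
    rw [mul_apply, sum_filter]
    refine sum_congr rfl fun w _ => ?_
    simp [stepMatrix]
  have hS : #S * (c * h ^ U) ≤ h ^ (s + t) * ∑ w ∈ S, M w z := by
    rw [mul_sum, ← nsmul_eq_mul, ← sum_const]
    refine sum_le_sum fun w hw => hM.le w z ?_ hz
    simp only [S, mem_filter] at hw
    exact hw.2.1
  have hpos : 0 < h ^ s := by positivity
  refine le_of_mul_le_mul_left ?_ hpos
  calc h ^ s * (c / 2 * h ^ (u + U)) = c / 2 * h ^ U * h ^ (s + u) := by ring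
    _ ≤ c / 2 * h ^ U * (2 * (h ^ s' * #S)) := by gcongr
    _ = h ^ s' * (#S * (c * h ^ U)) := by ring
    _ ≤ h ^ s' * (h ^ (s + t) * ∑ w ∈ S, M w z) := by gcongr
    _ = _ := by rw [hsum]; ring

end Steps

/-! ### Walks of length eight in a link -/

section LinkWalks

variable {V : Type*} [Fintype V] {G : SimpleGraph V} {p q d R : ℕ} {h : ℝ}

open Classical in
/-- Walks in a link, counted coordinatewise. -/
theorem prod_stepMatrix_le_link_pow (hpq : p < q) (x : Fin 3 → V)
    (L : List ((Fin 3 → ℕ) × (Fin 3 → ℕ)))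
    (hL : ∀ s ∈ L, s.1 ∈ arrangements p q ∧ s.2 ∈ arrangements p q)
    (y z : (polygraph G {p, q, p + q}).neighborSet x) :
    ∏ i, (L.map fun s => stepMatrix G (x i) (s.1 i, s.2 i)).prod (y.1 i) (z.1 i) ≤
      ((link (polygraph G {p, q, p + q}) x).adjMatrix ℝ ^ L.length) y z := by
  have hnn : ∀ (L : List ((Fin 3 → ℕ) × (Fin 3 → ℕ))) (i : Fin 3) (v w : V),
      0 ≤ (L.map fun s => stepMatrix G (x i) (s.1 i, s.2 i)).prod v w := by
    intro L i
    induction L with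
    | nil =>
      intro v w
      rw [List.map_nil, List.prod_nil, one_apply]
      split_ifs <;> simp
    | cons s L ih => exact mul_nonneg_apply (stepMatrix_nonneg _ _) ih
  induction L generalizing y with
  | nil =>
    simp only [List.map_nil, List.prod_nil, List.length_nil, pow_zero, one_apply]
    rw [prod_ite_zero]
    by_cases hyz : y = z
    · simp [hyz]
    · rw [if_neg hyz, if_neg]
      exact fun hall => hyz (Subtype.ext (funext fun i => hall i (mem_univ i)))
  | cons s L ih =>
    obtain ⟨hs, hL'⟩ := List.forall_mem_cons.mp hL
    simp only [List.map_cons, List.prod_cons, List.length_cons, pow_succ', mul_apply]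
    rw [prod_univ_sum, Fintype.piFinset_univ]
    -- Tuples of one-coordinate moves of the prescribed type are genuine edges of the link; all
    -- other edges only add to the count.
    calc _ ≤ ∑ w with (polygraph G {p, q, p + q}).Adj x w,
          (if (polygraph G {p, q, p + q}).Adj y.1 w then
            ∏ i, (L.map fun s => stepMatrix G (x i) (s.1 i, s.2 i)).prod (w i) (z.1 i) else 0) := by
          rw [sum_filter]
          refine sum_le_sum fun w _ => ?_
          rw [prod_mul_distrib]
          simp only [stepMatrix, of_apply]
          rw [prod_ite_zero]
          have hP := prod_nonneg fun i (_ : i ∈ univ) => hnn L i (w i) (z.1 i)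
          by_cases hw : ∀ i ∈ univ, G.dist (x i) (w i) = s.2 i ∧ G.dist (y.1 i) (w i) = s.1 i
          · have h1 : (polygraph G {p, q, p + q}).Adj x w := by
              rw [polygraph_adj_iff hpq, funext fun i => (hw i (mem_univ i)).1]
              exact hs.2
            have h2 : (polygraph G {p, q, p + q}).Adj y.1 w := by
              rw [polygraph_adj_iff hpq, funext fun i => (hw i (mem_univ i)).2]
              exact hs.1
            rw [if_pos hw, if_pos h1, if_pos h2, prod_const_one, one_mul]
          · rw [if_neg hw, zero_mul]
            split_ifs
            exacts [hP, le_rfl, le_rfl]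
      _ = ∑ w : (polygraph G {p, q, p + q}).neighborSet x,
          (if (polygraph G {p, q, p + q}).Adj y.1 w.1 then
            ∏ i, (L.map fun s => stepMatrix G (x i) (s.1 i, s.2 i)).prod (w.1 i) (z.1 i)
            else 0) := by
          rw [sum_subtype (p := fun w => w ∈ (polygraph G {p, q, p + q}).neighborSet x)]
          intro w
          simp
      _ ≤ _ := by
          refine sum_le_sum fun w _ => ?_
          rw [SimpleGraph.adjMatrix_apply]
          by_cases hw : (polygraph G {p, q, p + q}).Adj y.1 w.1
          · rw [if_pos hw, if_pos (by exact hw), one_mul]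
            exact ih hL' w
          · rw [if_neg hw, if_neg (by exact hw), zero_mul]

/-- A sequence of eight moves in a link, given by their lengths and the distances from the centre
after the move. It starts at distances `p, q, p + q`, and in each coordinate it passes through the
centre in two consecutive moves. -/
def refreshingSteps (p q : ℕ) (ω τ : Fin 3 → ℕ) : List ((Fin 3 → ℕ) × (Fin 3 → ℕ)) :=
  [(![p + q, q, p], ![q, p, p + q]), (![p + q, q, p], ![p, q, p + q]),
   (![q, p + q, p], ![q, p, p + q]), (![q, p + q, p], ![p, q, p + q]),
   (![p, q, p + q], ![p, p + q, q]), (![q, p, p + q], ![q, p + q, p]),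
   (![q, p, p + q], ![p, p + q, q]), (ω, τ)]

theorem refreshingSteps_mem {ω τ : Fin 3 → ℕ} (hω : ω ∈ arrangements p q)
    (hτ : τ ∈ arrangements p q) :
    ∀ s ∈ refreshingSteps p q ω τ, s.1 ∈ arrangements p q ∧ s.2 ∈ arrangements p q := by
  simp only [refreshingSteps, List.forall_mem_cons, hω, hτ, and_self, List.not_mem_nil,
    false_imp_iff, implies_true, and_true]
  refine ⟨?_, ?_, ?_, ?_, ?_, ?_, ?_⟩ <;>
    exact ⟨mem_arrangements_of_eq (by simp), mem_arrangements_of_eq (by simp)⟩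

/-- The first seven refreshing moves end at distances `p, p + q, q`; from there every arrangement
can be reached in a single move. -/
theorem exists_last_step (hp : Even p) (hq : Even q) (hpq : p < q) (hR : 3 * (p + q) ≤ 2 * R)
    {τ : Fin 3 → ℕ} (hτ : τ ∈ arrangements p q) :
    ∃ ω ∈ arrangements p q, ∀ r, IsTreeTriangle R (τ r) (![p, p + q, q] r) (ω r) := by
  obtain ⟨p, rfl⟩ := hp
  obtain ⟨q, rfl⟩ := hq
  have tri : ∀ {i j k : ℕ}, (i + j + k) % 2 = 0 → i + j + k ≤ 2 * R → i ≤ j + k → j ≤ i + k →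
      k ≤ i + j → IsTreeTriangle R i j k := fun h1 h2 h3 h4 h5 =>
    ⟨Nat.even_iff.mpr h1, h2, h3, h4, h5⟩
  rcases arrangements_cases (mem_arrangements_iff.mp hτ) with rfl | rfl | rfl | rfl | rfl | rfl
  · refine ⟨![p + p, q + q, p + p + (q + q)], mem_arrangements_of_eq (by simp), fun r => ?_⟩
    fin_cases r <;> apply tri <;> simp <;> omega
  · refine ⟨![p + p, p + p + (q + q), q + q], mem_arrangements_of_eq (by simp), fun r => ?_⟩
    fin_cases r <;> apply tri <;> simp <;> omega
  · refine ⟨![p + p + (q + q), q + q, p + p], mem_arrangements_of_eq (by simp), fun r => ?_⟩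
    fin_cases r <;> apply tri <;> simp <;> omega
  · refine ⟨![q + q, p + p, p + p + (q + q)], mem_arrangements_of_eq (by simp), fun r => ?_⟩
    fin_cases r <;> apply tri <;> simp <;> omega
  · refine ⟨![q + q, p + p + (q + q), p + p], mem_arrangements_of_eq (by simp), fun r => ?_⟩
    fin_cases r <;> apply tri <;> simp <;> omega
  · refine ⟨![q + q, p + p, p + p + (q + q)], mem_arrangements_of_eq (by simp), fun r => ?_⟩
    fin_cases r <;> apply tri <;> simp <;> omega

theorem isSpread_refreshingSteps [DecidableEq V] (hT : IsTreeLike G R) (hc : G.Connected)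
    (hreg : ∀ v, #{w | G.dist v w = 1} = d) (hd : 3 ≤ d) (hh : h ^ 2 = (d - 1 : ℕ)) (h0 : 0 < h)
    (hp : Even p) (hq : Even q) (hpq : p < q) (hR : 3 * (p + q) ≤ 2 * R) {ω τ : Fin 3 → ℕ}
    (hω : ∀ r, IsTreeTriangle R (τ r) (![p, p + q, q] r) (ω r)) (o : V) (r : Fin 3) :
    IsSpread G h o (1 / 2 ^ 7) (![p, q, p + q] r) (τ r)
      ((refreshingSteps p q ω τ).map fun s => s.1 r).sum
      ((refreshingSteps p q ω τ).map fun s => stepMatrix G o (s.1 r, s.2 r)).prod := by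
  have hω' := hω r
  obtain ⟨p, rfl⟩ := hp
  obtain ⟨q, rfl⟩ := hq
  have tri : ∀ {i j k : ℕ}, (i + j + k) % 2 = 0 ∧ i + j + k ≤ 2 * R ∧ i ≤ j + k ∧ j ≤ i + k ∧
      k ≤ i + j → IsTreeTriangle R i j k := fun h =>
    ⟨Nat.even_iff.mpr h.1, h.2.1, h.2.2.1, h.2.2.2.1, h.2.2.2.2⟩
  have right := fun {c : ℝ} (hc0 : 0 ≤ c) {s t U : ℕ} {M : Matrix V V ℝ} u t'
    (hM : IsSpread G h o c s t U M) (ht : IsTreeTriangle R t' t u) =>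
    hM.mul_stepMatrix hT hc hreg hd hh h0 hc0 ht
  have left := fun {c : ℝ} (hc0 : 0 ≤ c) {s t U : ℕ} {M : Matrix V V ℝ} u s'
    (hM : IsSpread G h o c s t U M) (ht : IsTreeTriangle R s' s u) =>
    hM.stepMatrix_mul hT hc hreg hd hh h0 hc0 ht
  have cross := fun s s' t hR hR' =>
    isSpread_cross hT hc hreg hd hh h0 o (s := s) (s' := s') (t := t) hR hR'
  fin_cases r
  -- The first coordinate crosses the centre in moves 1 and 2. Each of the six other moves costs a
  -- factor 2, on top of the `1 / 2` of the crossing.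
  · have a0 := cross (p + p) (p + p) (q + q) (by omega) (by omega)
    have a1 := right (by norm_num) (q + q) (q + q) a0 (tri (by omega))
    have a2 := right (by norm_num) (q + q) (p + p) a1 (tri (by omega))
    have a3 := right (by norm_num) (p + p) (p + p) a2 (tri (by omega))
    have a4 := right (by norm_num) (q + q) (q + q) a3 (tri (by omega))
    have a5 := right (by norm_num) (q + q) (p + p) a4 (tri (by omega))
    have a6 := right (by norm_num) (ω 0) (τ 0) a5 hω'
    convert a6 using 1
    · norm_num
    · rfl
    · rfl
    · simp [refreshingSteps]; ring
    · simp [refreshingSteps, mul_assoc]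
  -- The second coordinate crosses in moves 3 and 4; two moves precede.
  · have a0 := cross (q + q) (q + q) (p + p) (by omega) (by omega)
    have a1 := left (by norm_num) (q + q) (p + p) a0 (tri (by omega))
    have a2 := left (by norm_num) (q + q) (q + q) a1 (tri (by omega))
    have a3 := right (by norm_num) (q + q) (p + p + (q + q)) a2 (tri (by omega))
    have a4 := right (by norm_num) (p + p) (p + p + (q + q)) a3 (tri (by omega))
    have a5 := right (by norm_num) (p + p) (p + p + (q + q)) a4 (tri (by omega))
    have a6 := right (by norm_num) (ω 1) (τ 1) a5 hω'
    convert a6 using 1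
    · norm_num
    · rfl
    · rfl
    · simp [refreshingSteps]; ring
    · simp [refreshingSteps, mul_assoc, add_comm (q + q)]
  -- The third coordinate crosses in moves 6 and 7, after move 5 has brought it from distance `p +
  -- q` to `q`.
  · have a0 := cross (q + q) (q + q) (p + p) (by omega) (by omega)
    have a1 := left (by norm_num) (p + p + (q + q)) (p + p + (q + q)) a0 (tri (by omega))
    have a2 := left (by norm_num) (p + p) (p + p + (q + q)) a1 (tri (by omega))
    have a3 := left (by norm_num) (p + p) (p + p + (q + q)) a2 (tri (by omega))
    have a4 := left (by norm_num) (p + p) (p + p + (q + q)) a3 (tri (by omega))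
    have a5 := left (by norm_num) (p + p) (p + p + (q + q)) a4 (tri (by omega))
    have a6 := right (by norm_num) (ω 2) (τ 2) a5 hω'
    convert a6 using 1
    · norm_num
    · rfl
    · rfl
    · simp [refreshingSteps]; ring
    · simp [refreshingSteps, mul_assoc, add_comm (q + q)]

open Classical in
-- The three spread bounds multiply. Eight moves have total length `16(p+q)`, and the distances of
-- the two ends from the centre take away `2(p+q)` each; the constant is `(1 / 2^7)^3`.
theorem le_link_pow (hT : IsTreeLike G R) (hc : G.Connected)
    (hreg : ∀ v, #{w | G.dist v w = 1} = d) (hd : 3 ≤ d) (hh : h ^ 2 = (d - 1 : ℕ)) (h0 : 0 < h)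
    (hp : Even p) (hq : Even q) (hpq : p < q) (hR : 3 * (p + q) ≤ 2 * R) (x : Fin 3 → V)
    (y z : (polygraph G {p, q, p + q}).neighborSet x) :
    1 / 2 ^ 21 * h ^ (12 * (p + q)) ≤
      ((link (polygraph G {p, q, p + q}) x).adjMatrix ℝ ^ 8) y z := by
  have hy := (polygraph_adj_iff hpq).mp y.2
  have hz := (polygraph_adj_iff hpq).mp z.2
  obtain ⟨π, hπ⟩ := mem_arrangements_iff_exists.mp hy
  set τ : Fin 3 → ℕ := (fun i => G.dist (x i) (z.1 i)) ∘ π.symm with hτdef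
  have hτ : τ ∈ arrangements p q := comp_perm_mem_arrangements π.symm hz
  obtain ⟨ω, hω, htri⟩ := exists_last_step hp hq hpq hR hτ
  set S := refreshingSteps p q ω τ with hS
  have hspread := fun i r =>
    isSpread_refreshingSteps hT hc hreg hd hh h0 hp hq hpq hR htri (x i) r
  set U : Fin 3 → ℕ := fun r => (S.map fun s => s.1 r).sum with hU
  have hUsum : ∑ r, U r = 16 * (p + q) := by
    have := sum_of_mem_arrangements hω
    rw [Fin.sum_univ_three] at this ⊢
    simp [hU, hS, refreshingSteps]
    omega
  set M : Fin 3 → Matrix V V ℝ := fun i =>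
    (S.map fun s => stepMatrix G (x i) (s.1 (π i), s.2 (π i))).prod with hM
  have hle : ∀ i, 1 / 2 ^ 7 * h ^ U (π i) ≤
      h ^ (G.dist (x i) (y.1 i) + G.dist (x i) (z.1 i)) * M i (y.1 i) (z.1 i) := by
    intro i
    have h1 : ![p, q, p + q] (π i) = G.dist (x i) (y.1 i) := congrFun hπ i
    have h2 : τ (π i) = G.dist (x i) (z.1 i) := by simp [hτdef]
    have := (hspread i (π i)).le (y.1 i) (z.1 i) h1.symm h2.symm
    rwa [h1, h2] at this
  have hprod : ∏ i, M i (y.1 i) (z.1 i) ≤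
      ((link (polygraph G {p, q, p + q}) x).adjMatrix ℝ ^ 8) y z := by
    have := prod_stepMatrix_le_link_pow hpq x (S.map fun s => (s.1 ∘ π, s.2 ∘ π)) ?_ y z
    · simpa [hM, Function.comp_def, hS, refreshingSteps] using this
    · intro s hs
      obtain ⟨s', hs', rfl⟩ := List.mem_map.mp hs
      have := refreshingSteps_mem hω hτ s' hs'
      exact ⟨comp_perm_mem_arrangements π this.1, comp_perm_mem_arrangements π this.2⟩
  have hall := prod_le_prod (s := univ) (fun i _ => by positivity) fun i _ => hle i
  rw [prod_mul_distrib, prod_mul_distrib, prod_pow_eq_pow_sum, Equiv.sum_comp π U, hUsum] at hall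
  simp_rw [pow_add, prod_mul_distrib] at hall
  rw [prod_pow_of_mem_arrangements hy, prod_pow_of_mem_arrangements hz, prod_const, card_univ,
    Fintype.card_fin] at hall
  have hpos : 0 < h ^ (2 * (p + q)) * h ^ (2 * (p + q)) := by positivity
  refine le_of_mul_le_mul_left ?_ hpos
  calc _ = (1 / 2 ^ 7) ^ 3 * h ^ (16 * (p + q)) := by ring
    _ ≤ _ := hall
    _ ≤ _ := by gcongr

end LinkWalks

/-! ### Regularity and expansion of the links -/

section Regularity

variable {V : Type*} [Fintype V] {G : SimpleGraph V} {p q d R : ℕ}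

open Classical in
theorem isRegularOfDegree_of_card [G.LocallyFinite] (h : ∀ v, #{w | G.Adj v w} = d) :
    G.IsRegularOfDegree d := by
  intro v
  rw [← h v, ← SimpleGraph.card_neighborFinset_eq_degree]
  congr 1
  ext w
  simp

theorem card_dist_eq_one [G.LocallyFinite] (h : G.IsRegularOfDegree d) (v : V) :
    #{w | G.dist v w = 1} = d := by
  rw [← h v, ← SimpleGraph.card_neighborFinset_eq_degree]
  congr 1
  ext w
  simp [SimpleGraph.dist_eq_one_iff_adj]

open Classical in
theorem card_link_adj {x : V} (y : G.neighborSet x) :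
    #{w | (link G x).Adj y w} = #{z | G.Adj x z ∧ G.Adj y.1 z} := by
  refine card_bij (fun w _ => w.1) ?_ (fun _ _ _ _ h => Subtype.ext h) ?_
  · intro w hw
    simp only [mem_filter, mem_univ, true_and] at hw ⊢
    exact ⟨w.2, hw⟩
  · intro z hz
    simp only [mem_filter, mem_univ, true_and] at hz
    refine ⟨⟨z, hz.1⟩, ?_, rfl⟩
    simp only [mem_filter, mem_univ, true_and]
    exact hz.2

theorem exists_sq_eq (hd : 3 ≤ d) : ∃ h : ℝ, h ^ 2 = (d - 1 : ℕ) ∧ 0 < h := by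
  have : (0 : ℝ) < (d - 1 : ℕ) := by
    have : 0 < d - 1 := by omega
    exact_mod_cast this
  exact ⟨√(d - 1 : ℕ), Real.sq_sqrt this.le, Real.sqrt_pos.mpr this⟩

theorem polygraphDegree_pos (hd : 3 ≤ d) : 0 < polygraphDegree p q d := by
  obtain ⟨h, hh, h0⟩ := exists_sq_eq hd
  have h1 := le_polygraphDegree (p := p) (q := q) hd hh h0
  have h2 : 0 < h ^ (4 * (p + q)) := by positivity
  have h3 : (0 : ℝ) < polygraphDegree p q d := by linarith
  exact_mod_cast h3

theorem polygraphLinkDegree_pos (hp : Even p) (hq : Even q) (hd : 3 ≤ d) :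
    0 < polygraphLinkDegree p q d := by
  obtain ⟨h, hh, h0⟩ := exists_sq_eq hd
  have hmem := base_mem_arrangements (p := p) (q := q)
  refine sum_pos' (fun _ _ => Nat.zero_le _) ⟨_, hmem, ?_⟩
  refine sum_pos' (fun _ _ => Nat.zero_le _) ⟨_, hmem, ?_⟩
  refine prod_pos fun i _ => ?_
  have he := even_of_mem_arrangements hp hq hmem i
  have h1 := le_triangleCount (R := 2 * ![p, q, p + q] i) hd hh h0
    (i := ![p, q, p + q] i) (j := ![p, q, p + q] i) (k := ![p, q, p + q] i)
    ⟨(he.add he).add he, by omega, by omega, by omega, by omega⟩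
  have h2 : 0 < h ^ (![p, q, p + q] i + ![p, q, p + q] i) := by positivity
  rw [Nat.pos_iff_ne_zero]
  intro h3
  rw [h3] at h1
  simp only [Nat.cast_zero, mul_zero] at h1
  linarith

open Classical in
theorem polygraph_isRegularOfDegree (hT : IsTreeLike G R) (hc : G.Connected)
    (hreg : ∀ v, #{w | G.dist v w = 1} = d) (hpq : p < q) (hR : 3 * (p + q) ≤ 2 * R) :
    (polygraph G {p, q, p + q} : SimpleGraph (Fin 3 → V)).IsRegularOfDegree
      (polygraphDegree p q d) :=
  isRegularOfDegree_of_card fun x => card_polygraph_neighbors hT hc hreg hpq (by omega) x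

open Classical in
theorem link_isRegularOfDegree (hT : IsTreeLike G R) (hc : G.Connected)
    (hreg : ∀ v, #{w | G.dist v w = 1} = d) (hp : Even p) (hq : Even q) (hpq : p < q)
    (hR : 3 * (p + q) ≤ 2 * R) (x : Fin 3 → V) :
    (link (polygraph G {p, q, p + q}) x).IsRegularOfDegree (polygraphLinkDegree p q d) := by
  refine isRegularOfDegree_of_card fun y => ?_
  convert (card_link_adj y).trans (card_polygraph_common_neighbors hT hc hreg hp hq hpq hR y.2)

open Classical in
theorem polygraph_isABRegular (hT : IsTreeLike G R) (hc : G.Connected)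
    (hreg : ∀ v, #{w | G.dist v w = 1} = d) (hd : 3 ≤ d) (hp : Even p) (hq : Even q) (hpq : p < q)
    (hR : 3 * (p + q) ≤ 2 * R) :
    IsABRegular (polygraph G {p, q, p + q} : SimpleGraph (Fin 3 → V)) (polygraphDegree p q d)
      (polygraphLinkDegree p q d) := by
  refine ⟨?_, ?_, fun x => ?_⟩
  · obtain ⟨v⟩ := hc.nonempty
    have hN := card_polygraph_neighbors hT hc hreg hpq (by omega) (fun _ => v)
    have hpos := polygraphDegree_pos (p := p) (q := q) hd
    rw [← hN] at hpos
    obtain ⟨y, hy⟩ := card_pos.mp hpos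
    have hy' := (mem_filter.mp hy).2
    rw [← hN, ← card_polygraph_common_neighbors hT hc hreg hp hq hpq hR hy']
    -- The common neighbours of `x` and `y` are neighbours of `x` other than `y` itself.
    refine card_lt_card ((ssubset_iff_of_subset ?_).mpr ⟨y, hy, ?_⟩)
    · intro z hz
      simp only [mem_filter, mem_univ, true_and] at hz ⊢
      exact hz.1
    · simp
  · exact polygraph_isRegularOfDegree hT hc hreg hpq hR
  · convert link_isRegularOfDegree hT hc hreg hp hq hpq hR x

/-- A lower bound for the spectral gap of the links of the polygraph `G_{[p,q,p+q]}`. -/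
noncomputable def linkGap (p q : ℕ) : ℝ :=
  1 / (2 ^ 24 * (8 * (#(arrangements p q) : ℝ) ^ 2) ^ 8) / 8

theorem card_arrangements_pos : 0 < #(arrangements p q) := card_pos.mpr ⟨_, base_mem_arrangements⟩

theorem linkGap_pos (p q : ℕ) : 0 < linkGap p q := by
  have : (0 : ℝ) < #(arrangements p q) := by exact_mod_cast card_arrangements_pos
  rw [linkGap]
  positivity

open Classical in
theorem polygraph_isLocalSpectralExpander (hT : IsTreeLike G R) (hc : G.Connected)
    (hreg : ∀ v, #{w | G.dist v w = 1} = d) (hd : 3 ≤ d) (hp : Even p) (hq : Even q) (hpq : p < q)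
    (hR : 3 * (p + q) ≤ 2 * R) :
    IsLocalSpectralExpander (polygraph G {p, q, p + q} : SimpleGraph (Fin 3 → V))
      (polygraphLinkDegree p q d) (linkGap p q) := by
  intro x
  obtain ⟨h, hh, h0⟩ := exists_sq_eq hd
  have hbpos := polygraphLinkDegree_pos hp hq hd
  have hlink := link_isRegularOfDegree hT hc hreg hp hq hpq hR x
  refine ⟨hbpos, by convert hlink, ?_⟩
  have h1 := polygraphLinkDegree_le hp hq hd hh h0
  have hgap : linkGap p q = 1 / (2 ^ 24 * (8 * (#(arrangements p q) : ℝ) ^ 2) ^ 8) / 8 := rfl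
  have hK1 : 1 ≤ 8 * (#(arrangements p q) : ℝ) ^ 2 := by
    have : (1 : ℝ) ≤ #(arrangements p q) := by
      exact_mod_cast Nat.succ_le_of_lt card_arrangements_pos
    nlinarith
  generalize 8 * (#(arrangements p q) : ℝ) ^ 2 = K at h1 hgap hK1
  generalize polygraphLinkDegree p q d = b at *
  have hcard : (Fintype.card ((polygraph G {p, q, p + q}).neighborSet x) : ℝ) =
      polygraphDegree p q d := by
    rw [← card_polygraph_neighbors hT hc hreg hpq (by omega) x]
    congr 1
    rw [SimpleGraph.card_neighborSet_eq_degree, ← SimpleGraph.card_neighborFinset_eq_degree]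
    congr 1
    ext w
    simp
  -- `2 ^ 24` combines `2 ^ 21` from the walk count with the `8` from the lower bound on the number
  -- of vertices; `K ^ 8` bounds the eighth power of the degree. All powers of `h` cancel.
  have hbound := adjEigenvalue_two_le_of_pow (G := link (polygraph G {p, q, p + q}) x)
    (d := b) (k := 8) (m := 1 / 2 ^ 21 * h ^ (12 * (p + q))) (δ := 1 / (2 ^ 24 * K ^ 8))
    (by convert hlink) (by norm_num) ?_ ?_ ?_
  · have hb' : (0 : ℝ) < b := by exact_mod_cast hbpos
    have : adjEigenvalue (link (polygraph G {p, q, p + q}) x) 2 / b ≤ 1 - linkGap p q := by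
      rw [div_le_iff₀ hb', hgap]
      rwa [Nat.cast_ofNat] at hbound
    linarith
  · rw [div_le_one (by positivity)]
    have := one_le_pow₀ (n := 8) hK1
    linarith
  · intro y z
    convert le_link_pow hT hc hreg hd hh h0 hp hq hpq hR x y z
  · rw [hcard]
    have h2 := le_polygraphDegree (p := p) (q := q) hd hh h0
    have h3 : (b : ℝ) ^ 8 ≤ K ^ 8 * h ^ (16 * (p + q)) := by
      calc (b : ℝ) ^ 8 ≤ (K * h ^ (2 * (p + q))) ^ 8 := by gcongr
        _ = _ := by ring
    calc 1 / (2 ^ 24 * K ^ 8) * (b : ℝ) ^ 8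
        ≤ 1 / (2 ^ 24 * K ^ 8) * (K ^ 8 * h ^ (16 * (p + q))) := by gcongr
      _ = 1 / 2 ^ 21 * h ^ (12 * (p + q)) * (h ^ (4 * (p + q)) / 8) := by
          field_simp
          ring
      _ ≤ _ := by
          gcongr
          linarith

end Regularity

/-! ### Expansion of the whole polygraph -/

section Global

variable {V : Type*} [Fintype V] {G : SimpleGraph V} {p q d R : ℕ}

/-- Products of the members of a complete system of functions form a complete system. -/
theorem eq_zero_of_forall_sum_prod_eq_zero {ι : Type*} {f : ι → V → ℝ}
    (hf : ∀ g : V → ℝ, (∀ j, f j ⬝ᵥ g = 0) → g = 0) {n : ℕ} {F : (Fin n → V) → ℝ}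
    (h : ∀ J : Fin n → ι, ∑ y, (∏ i, f (J i) (y i)) * F y = 0) : F = 0 := by
  induction n with
  | zero =>
    ext y
    have := h Fin.elim0
    simpa [Subsingleton.elim y default] using this
  | succ n ih =>
    have h1 : ∀ (J : Fin n → ι) (a : V),
        ∑ y, (∏ i, f (J i) (y i)) * F (Fin.cons a y) = 0 := by
      intro J
      refine congrFun (hf (fun a => ∑ y, (∏ i, f (J i) (y i)) * F (Fin.cons a y)) fun j => ?_)
      have h2 := h (Fin.cons j J)
      rw [← (Fin.consEquiv fun _ => V).sum_comp, Fintype.sum_prod_type] at h2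
      rw [dotProduct, ← h2]
      refine sum_congr rfl fun a _ => ?_
      rw [mul_sum]
      refine sum_congr rfl fun y _ => ?_
      simp [Fin.consEquiv, Fin.prod_univ_succ, mul_assoc]
    ext y
    have := congrFun (ih fun J => h1 J (y 0)) (Fin.tail y)
    simpa using this

open Classical in
theorem polygraph_mulVec_prod (hT : IsTreeLike G R) (hc : G.Connected)
    (hreg : ∀ v, #{w | G.dist v w = 1} = d) (hd : 3 ≤ d) (hpq : p < q)
    (hR : 3 * (p + q) ≤ 2 * R) {f : Fin 3 → V → ℝ} {μ : Fin 3 → ℝ}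
    (hf : ∀ i, G.adjMatrix ℝ *ᵥ f i = μ i • f i) :
    (polygraph G {p, q, p + q}).adjMatrix ℝ *ᵥ (fun y => ∏ i, f i (y i)) =
      (∑ u ∈ arrangements p q, (∏ i, (triangleCount d 0 (u i) (u i) : ℝ)) *
        ∏ i, sphericalValue (d : ℝ)⁻¹ (μ i / d) (u i)) • (fun y => ∏ i, f i (y i)) := by
  have hf' : ∀ i w, ∑ z with G.dist w z = 1, f i z = μ i * f i w := by
    intro i w
    have := congrFun (hf i) w
    simp only [mulVec, dotProduct, SimpleGraph.adjMatrix_apply, ite_mul, one_mul, zero_mul,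
      Pi.smul_apply, smul_eq_mul] at this
    rw [← this, sum_filter]
    simp only [SimpleGraph.dist_eq_one_iff_adj]
  ext x
  simp only [mulVec, dotProduct, SimpleGraph.adjMatrix_apply, ite_mul, one_mul, zero_mul,
    Pi.smul_apply, smul_eq_mul]
  rw [← sum_filter]
  simp_rw [polygraph_adj_iff hpq]
  rw [sum_arrangements_fiberwise, sum_mul]
  refine sum_congr rfl fun u hu => ?_
  have : ({y | ∀ i, G.dist (x i) (y i) = u i} : Finset (Fin 3 → V)) =
      Fintype.piFinset fun i => ({v | G.dist (x i) v = u i} : Finset V) := by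
    ext y; simp
  rw [this, ← prod_univ_sum (fun i => ({v | G.dist (x i) v = u i} : Finset V)) fun i v => f i v,
    ← prod_mul_distrib, ← prod_mul_distrib]
  refine prod_congr rfl fun i _ => ?_
  refine hT.sum_sphere_eigenvector hc hreg hd (hf' i) (x i) ?_
  have := apply_of_mem_arrangements hu i
  omega

/-- All arrangements carry the same weight `Q` and no product of spherical values exceeds 1, so a
gain in one arrangement lowers the average by that gain over the number of arrangements. -/
theorem sum_prod_sphericalValue_le (hd : 3 ≤ d) {γ : ℝ} (hγ : 0 < γ) {μ : Fin 3 → ℝ}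
    (hμ : ∀ i, μ i = d ∨ |μ i| ≤ (1 - γ) * d) {i₀ : Fin 3} (hi₀ : |μ i₀| ≤ (1 - γ) * d)
    (hpq : p < q) :
    ∑ u ∈ arrangements p q, (∏ i, (triangleCount d 0 (u i) (u i) : ℝ)) *
        ∏ i, sphericalValue (d : ℝ)⁻¹ (μ i / d) (u i) ≤
      (1 - 3 / 8 * γ / #(arrangements p q)) * polygraphDegree p q d := by
  have hd0 : (0 : ℝ) < d := by positivity
  have hθ0 : (0 : ℝ) ≤ (d : ℝ)⁻¹ := by positivity
  have hθ : (d : ℝ)⁻¹ ≤ 1 / 3 := by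
    rw [one_div]
    gcongr
    exact_mod_cast hd
  have hx : ∀ i, |μ i| ≤ (1 - γ) * d → |μ i / d| ≤ 1 - γ := by
    intro i hi
    rwa [abs_div, abs_of_pos hd0, div_le_iff₀ hd0]
  have hone : ∀ i r, |sphericalValue (d : ℝ)⁻¹ (μ i / d) r| ≤ 1 := by
    intro i r
    rcases hμ i with h | h
    · rw [h, div_self hd0.ne', sphericalValue_one hθ, abs_one]
    · exact abs_sphericalValue_le_one hθ0 hθ hγ (hx i h) r
  set Q : ℝ := (triangleCount d 0 p p : ℝ) * triangleCount d 0 q q *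
    triangleCount d 0 (p + q) (p + q) with hQ
  have hQ0 : 0 ≤ Q := by positivity
  have hprod : ∀ u ∈ arrangements p q, ∏ i, (triangleCount d 0 (u i) (u i) : ℝ) = Q :=
    fun u hu => prod_of_mem_arrangements (fun r => (triangleCount d 0 r r : ℝ)) hu
  have hdeg : (polygraphDegree p q d : ℝ) = #(arrangements p q) * Q := by
    rw [polygraphDegree]
    push_cast
    rw [sum_congr rfl hprod, sum_const, nsmul_eq_mul]
  have habs : ∀ u : Fin 3 → ℕ, ∏ i, sphericalValue (d : ℝ)⁻¹ (μ i / d) (u i) ≤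
      |sphericalValue (d : ℝ)⁻¹ (μ i₀ / d) (u i₀)| := by
    intro u
    refine (le_abs_self _).trans ?_
    rw [abs_prod, ← mul_prod_erase univ _ (mem_univ i₀)]
    exact mul_le_of_le_one_right (abs_nonneg _)
      (prod_le_one (fun _ _ => abs_nonneg _) fun i _ => hone i _)
  -- The nontrivial coordinate is given the distance `q`, which is positive; `p` may be `0` and
  -- would give no gain.
  set u₀ : Fin 3 → ℕ := ![p, q, p + q] ∘ Equiv.swap i₀ 1
  have hu₀ : u₀ ∈ arrangements p q := comp_perm_mem_arrangements _ base_mem_arrangements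
  have hu₀q : u₀ i₀ = q := by simp [u₀]
  have hgain : ∏ i, sphericalValue (d : ℝ)⁻¹ (μ i / d) (u₀ i) ≤ 1 - 3 / 8 * γ := by
    refine (habs u₀).trans ?_
    rw [hu₀q, ← Nat.sub_add_cancel (by omega : 1 ≤ q)]
    exact abs_sphericalValue_succ_le hθ0 hθ hγ (hx i₀ hi₀) _
  have hcard : (0 : ℝ) < #(arrangements p q) := by exact_mod_cast card_arrangements_pos
  calc _ = ∑ u ∈ arrangements p q, Q * ∏ i, sphericalValue (d : ℝ)⁻¹ (μ i / d) (u i) :=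
        sum_congr rfl fun u hu => by rw [hprod u hu]
    _ = Q * ∏ i, sphericalValue (d : ℝ)⁻¹ (μ i / d) (u₀ i) +
        ∑ u ∈ (arrangements p q).erase u₀,
          Q * ∏ i, sphericalValue (d : ℝ)⁻¹ (μ i / d) (u i) := (add_sum_erase _ _ hu₀).symm
    _ ≤ Q * (1 - 3 / 8 * γ) + ∑ u ∈ (arrangements p q).erase u₀, Q := by
        gcongr with u hu
        exact mul_le_of_le_one_right hQ0 ((habs u).trans (hone _ _))
    _ = (∑ u ∈ arrangements p q, Q) - Q * (3 / 8 * γ) := by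
        rw [← add_sum_erase _ _ hu₀]
        ring
    _ = _ := by
        rw [hdeg, sum_const, nsmul_eq_mul]
        field_simp

open Classical in
theorem polygraph_isSpectralExpander (hT : IsTreeLike G R) (hc : G.Connected)
    (hdeg : G.IsRegularOfDegree d) (hd : 3 ≤ d) (hpq : p < q) (hR : 3 * (p + q) ≤ 2 * R) {γ : ℝ}
    (hγ : 0 < γ) (hle : γ ≤ spectralGap G d) :
    IsSpectralExpander (polygraph G {p, q, p + q} : SimpleGraph (Fin 3 → V))
      (polygraphDegree p q d) (3 / 8 * γ / #(arrangements p q)) := by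
  have hreg := card_dist_eq_one hdeg
  have hpos := polygraphDegree_pos (p := p) (q := q) hd
  have hreg' := polygraph_isRegularOfDegree hT hc hreg hpq hR
  refine ⟨hpos, hreg', ?_⟩
  have : Nonempty V := hc.nonempty
  obtain ⟨f, μ, j₀, hf, hcomplete, ⟨c, hconst⟩, hj₀, hμ⟩ :=
    exists_eigenbasis_of_le_spectralGap hdeg (by omega) hγ hle
  have hcard : 2 ≤ Fintype.card (Fin 3 → V) := by
    have h1 := (polygraph G {p, q, p + q} : SimpleGraph (Fin 3 → V)).degree_lt_card_verts
      (fun _ => j₀)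
    rw [hreg' _] at h1
    omega
  obtain ⟨F, ν, hF0, hFs, hF, hν⟩ := exists_eigenvector_adjEigenvalue_two_le hreg' hcard
  obtain ⟨J, hJ⟩ : ∃ J : Fin 3 → V, ∑ y, (∏ i, f (J i) (y i)) * F y ≠ 0 := by
    by_contra hall
    push Not at hall
    exact hF0 (eq_zero_of_forall_sum_prod_eq_zero hcomplete hall)
  have hΦ := polygraph_mulVec_prod hT hc hreg hd hpq hR (f := fun i => f (J i))
    (μ := fun i => μ (J i)) fun i => hf (J i)
  have hνeq := (mul_eq_zero.mp (mul_dotProduct_of_eigenvectors hΦ hF)).resolve_right hJ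
  -- Were every factor constant, the product would be constant and orthogonal to `F`, whose sum is
  -- zero.
  obtain ⟨i₀, hi₀⟩ : ∃ i, J i ≠ j₀ := by
    by_contra hall
    push Not at hall
    apply hJ
    simp only [hall, hconst, prod_const, ← mul_sum, hFs, mul_zero]
  have hbound := sum_prod_sphericalValue_le (p := p) (q := q) hd hγ (μ := fun i => μ (J i))
    (fun i => by
      by_cases h : J i = j₀
      · exact Or.inl (by rw [h, hj₀])
      · exact Or.inr (hμ _ h)) (hμ _ hi₀) hpq
  have hpos' : (0 : ℝ) < polygraphDegree p q d := by exact_mod_cast hpos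
  have : adjEigenvalue (polygraph G {p, q, p + q} : SimpleGraph (Fin 3 → V)) 2 /
      polygraphDegree p q d ≤ 1 - 3 / 8 * γ / #(arrangements p q) := by
    rw [div_le_iff₀ hpos']
    linarith
  linarith

end Global

theorem theorem3 (p q : ℕ) (hp : Even p) (hq : Even q) (hpq : p < q) :
    ∃ (a b : ℕ → ℕ) (ε : ℝ) (ε' : ℝ → ℝ),
      0 < ε ∧ (∀ γ : ℝ, 0 < γ → 0 < ε' γ) ∧
      ∀ (d : ℕ) (V : Type u) [Fintype V] (G : SimpleGraph V) [DecidableRel G.Adj],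
        3 ≤ d → G.IsRegularOfDegree d → G.Connected → ¬ G.IsBipartite →
        ((3 * p + 3 * q : ℕ) : ℕ∞) < G.egirth →
        let GS : SimpleGraph (Fin 3 → V) := polygraph G {p, q, p + q}
        IsABRegular GS (a d) (b d) ∧
        IsLocalSpectralExpander GS (b d) ε ∧
        0 < spectralGap G d ∧
        ∀ γ : ℝ, 0 < γ → γ ≤ spectralGap G d → IsSpectralExpander GS (a d) (ε' γ) := by
  classical
  refine ⟨polygraphDegree p q, polygraphLinkDegree p q, linkGap p q,
    fun γ => 3 / 8 * γ / #(arrangements p q), linkGap_pos p q, ?_, ?_⟩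
  · intro γ hγ
    have : (0 : ℝ) < #(arrangements p q) := by exact_mod_cast card_arrangements_pos
    positivity
  intro d V _ G _ hd hdeg hc hb hg
  -- `2R` is the largest perimeter of a triangle whose sides are at most `p + q`.
  obtain ⟨R, hR⟩ : ∃ R, 3 * p + 3 * q = 2 * R := by
    obtain ⟨p', rfl⟩ := hp
    obtain ⟨q', rfl⟩ := hq
    exact ⟨3 * (p' + q'), by ring⟩
  rw [hR] at hg
  have hT := isTreeLike_of_lt_egirth hc hg
  have hR' : 3 * (p + q) ≤ 2 * R := by omega
  have hreg := card_dist_eq_one hdeg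
  refine ⟨polygraph_isABRegular hT hc hreg hd hp hq hpq hR',
    polygraph_isLocalSpectralExpander hT hc hreg hd hp hq hpq hR', ?_, fun γ hγ hle => ?_⟩
  · refine spectralGap_pos ?_ (by omega) hc hb
    convert hdeg
  · refine polygraph_isSpectralExpander hT hc ?_ hd hpq hR' hγ hle
    convert hdeg
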